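/- All $C^*$-tensor products are minimal, $M(B)$ denotes the multiplier algebra of a $C^*$-algebra $B$, and $\iota$ denotes the identity map. A $*$-homomorphism $\gamma : A \to M(B)$ is nondegenerate if the linear span of $\gamma(A)B$ is dense in $B$; such a map extends uniquely to a unital $*$-homomorphism $M(A) \to M(B)$. A comultiplication on $A$ is a nondegenerate $*$-homomorphism $\phi : A \to M(A\otimes A)$ with $(\phi\otimes\iota)\phi = (\iota\otimes\phi)\phi$, where $\phi\otimes\iota$ and $\iota\otimes\phi$ are extended to $*$-homomorphisms $M(A\otimes A)\to M(A\otimes A\otimes A)$. **Proposition.** Let $A$ be a nonzero abelian $C^*$-algebra with a comultiplication $\phi$ such that $\phi(a)(1\otimes b)$ and $\phi(a)(b\otimes 1)$ lie in $A\otimes A$ for all $a,b\in A$. Assume that for all $a,b\in A$ $$\phi(a)(1\otimes b)=0 \ \text{ implies } \ a\otimes b=0, \qquad\text{and}\qquad \phi(a)(b\otimes 1)=0 \ \text{ implies } \ a\otimes b=0 .$$ Then there exist a locally compact Hausdorff topological group $G$ and a $*$-isomorphism $A\cong C_0(G)$ under which $\phi$ is given by $$\phi(f)(p,q)=f(pq)\qquad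 (f\in C_0(G),\ p,q\in G).$$ Here $A\otimes A$ is identified with $C_0(G\times G)$ through the $*$-isomorphism with $(f\otimes g)(p,q)=f(p)g(q)$, and so $M(A\otimes A)$ with the algebra of bounded continuous functions on $G\times G$, acting on $C_0(G\times G)$ by multiplication. -/

import Mathlib

open scoped TensorProduct ENNReal MultiplierAlgebra ZeroAtInfty

universe u v w

namespace CStarTensor

noncomputable section

/-! ### Hilbert space tensor products -/

section HilbertTensor

variable (H : Type u) (K : Type v) (L : Type w)
  [NormedAddCommGroup H] [InnerProductSpace ℂ H] [NormedAddCommGroup K] [InnerProductSpace ℂ K]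
  [NormedAddCommGroup L] [InnerProductSpace ℂ L]

/-- The Hilbert space tensor product of two inner product spaces. -/
abbrev HTensor := UniformSpace.Completion (H ⊗[ℂ] K)

variable {H K L}

/-- The elementary tensor `h ⊗ k`. -/
def htmul (h : H) (k : K) : HTensor H K := ((h ⊗ₜ[ℂ] k : H ⊗[ℂ] K) : HTensor H K)

lemma htmul_norm (h : H) (k : K) : ‖htmul h k‖ = ‖h‖ * ‖k‖ := by
  simp [htmul]

lemma htmul_inner (h h' : H) (k k' : K) :
    inner ℂ (htmul h k) (htmul h' k') = inner ℂ h h' * inner ℂ k k' := by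
  simp [htmul]

variable (H K) in
/-- The bounded bilinear map `(h, k) ↦ h ⊗ k`. -/
def htmulL : H →L[ℂ] K →L[ℂ] HTensor H K :=
  LinearMap.mkContinuous₂ ((TensorProduct.mk ℂ H K).compr₂
    (UniformSpace.Completion.toComplL (𝕜 := ℂ) (E := H ⊗[ℂ] K)).toLinearMap) 1
    (fun h k => by
      rw [one_mul]; exact (htmul_norm h k).le)

@[simp] lemma htmulL_apply (h : H) (k : K) : htmulL H K h k = htmul h k := rfl

lemma htmul_add_left (h h' : H) (k : K) : htmul (h + h') k = htmul h k + htmul h' k := by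
  simp [← htmulL_apply]

lemma htmul_add_right (h : H) (k k' : K) : htmul h (k + k') = htmul h k + htmul h k' := by
  simp [← htmulL_apply]

lemma htmul_smul_left (c : ℂ) (h : H) (k : K) : htmul (c • h) k = c • htmul h k := by
  simp [← htmulL_apply]

lemma htmul_smul_right (c : ℂ) (h : H) (k : K) : htmul h (c • k) = c • htmul h k := by
  simp [← htmulL_apply]

variable (H K) in
lemma span_htmul_dense :
    (Submodule.span ℂ (Set.range fun p : H × K => htmul p.1 p.2)).topologicalClosure = ⊤ := by
  rw [← Submodule.dense_iff_topologicalClosure_eq_top]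
  refine (UniformSpace.Completion.denseRange_coe (α := H ⊗[ℂ] K)).mono ?_
  rintro _ ⟨x, rfl⟩
  induction x using TensorProduct.induction_on with
  | zero =>
    rw [UniformSpace.Completion.coe_zero]
    exact zero_mem _
  | tmul h k => exact Submodule.subset_span ⟨(h, k), rfl⟩
  | add x y hx hy =>
    rw [UniformSpace.Completion.coe_add]
    exact add_mem hx hy

/-- Bounded linear maps on a Hilbert space tensor product are determined by their values on
elementary tensors. -/
lemma htensor_ext {E : Type*} [NormedAddCommGroup E] [NormedSpace ℂ E]
    {f g : HTensor H K →L[ℂ] E} (h : ∀ x y, f (htmul x y) = g (htmul x y)) : f = g := by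
  refine ContinuousLinearMap.ext_on (s := Set.range fun p : H × K => htmul p.1 p.2) ?_ ?_
  · rw [Submodule.dense_iff_topologicalClosure_eq_top]
    exact span_htmul_dense H K
  · rintro _ ⟨p, rfl⟩
    exact h _ _

/-- The operator `S ⊗ T` on the Hilbert space tensor product. -/
def opTensor (S : H →L[ℂ] H) (T : K →L[ℂ] K) : HTensor H K →L[ℂ] HTensor H K :=
  (TensorProduct.mapL S T).completion

@[simp] lemma opTensor_htmul (S : H →L[ℂ] H) (T : K →L[ℂ] K) (h : H) (k : K) :
    opTensor S T (htmul h k) = htmul (S h) (T k) := by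
  simp [opTensor, htmul]

lemma opTensor_norm_le (S : H →L[ℂ] H) (T : K →L[ℂ] K) : ‖opTensor S T‖ ≤ ‖S‖ * ‖T‖ := by
  refine ContinuousLinearMap.opNorm_le_bound _ (by positivity) fun x => ?_
  induction x using UniformSpace.Completion.induction_on with
  | hp =>
    exact isClosed_le (continuous_norm.comp (opTensor S T).continuous)
      (continuous_const.mul continuous_norm)
  | ih x =>
    simp only [opTensor, ContinuousLinearMap.completion_apply_coe, UniformSpace.Completion.norm_coe]
    exact ((TensorProduct.mapL S T).le_opNorm x).trans
      (by gcongr; exact TensorProduct.norm_mapL_le S T)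

lemma opTensor_mul (S S' : H →L[ℂ] H) (T T' : K →L[ℂ] K) :
    opTensor (S * S') (T * T') = opTensor S T * opTensor S' T' :=
  htensor_ext fun x y => by simp

lemma opTensor_add_left (S S' : H →L[ℂ] H) (T : K →L[ℂ] K) :
    opTensor (S + S') T = opTensor S T + opTensor S' T :=
  htensor_ext fun x y => by simp [htmul_add_left]

lemma opTensor_add_right (S : H →L[ℂ] H) (T T' : K →L[ℂ] K) :
    opTensor S (T + T') = opTensor S T + opTensor S T' :=
  htensor_ext fun x y => by simp [htmul_add_right]

lemma opTensor_smul_left (c : ℂ) (S : H →L[ℂ] H) (T : K →L[ℂ] K) :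
    opTensor (c • S) T = c • opTensor S T :=
  htensor_ext fun x y => by simp [htmul_smul_left]

lemma opTensor_smul_right (c : ℂ) (S : H →L[ℂ] H) (T : K →L[ℂ] K) :
    opTensor S (c • T) = c • opTensor S T :=
  htensor_ext fun x y => by simp [htmul_smul_right]

lemma opTensor_star [CompleteSpace H] [CompleteSpace K] (S : H →L[ℂ] H) (T : K →L[ℂ] K) :
    opTensor (star S) (star T) = star (opTensor S T) := by
  rw [ContinuousLinearMap.star_eq_adjoint (opTensor S T), ContinuousLinearMap.eq_adjoint_iff]
  intro x y
  induction x, y using UniformSpace.Completion.induction_on₂ with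
  | hp =>
    exact isClosed_eq
      (((opTensor (star S) (star T)).continuous.comp continuous_fst).inner continuous_snd)
      (continuous_fst.inner ((opTensor S T).continuous.comp continuous_snd))
  | ih x y =>
    simp only [opTensor, ContinuousLinearMap.completion_apply_coe,
      UniformSpace.Completion.inner_coe]
    induction x using TensorProduct.induction_on with
    | zero => simp
    | add x x' hx hx' => simp only [map_add, inner_add_left, hx, hx']
    | tmul a b =>
      induction y using TensorProduct.induction_on with
      | zero => simp
      | add y y' hy hy' => simp only [map_add, inner_add_right, hy, hy']
      | tmul c d =>
        simp [ContinuousLinearMap.star_eq_adjoint, ContinuousLinearMap.adjoint_inner_left]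

variable (H K) in
/-- `T ↦ 1 ⊗ T` as a star homomorphism. -/
def opTensorRight [CompleteSpace H] [CompleteSpace K] :
    (K →L[ℂ] K) →⋆ₙₐ[ℂ] (HTensor H K →L[ℂ] HTensor H K) where
  toFun T := opTensor 1 T
  map_smul' c T := opTensor_smul_right c 1 T
  map_zero' := by simpa using opTensor_smul_right (0 : ℂ) (1 : H →L[ℂ] H) (0 : K →L[ℂ] K)
  map_add' := opTensor_add_right 1
  map_mul' T T' := by rw [← opTensor_mul, one_mul]
  map_star' T := by rw [← opTensor_star, star_one]

variable (H K) in
/-- `S ↦ S ⊗ 1` as a star homomorphism. -/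
def opTensorLeft [CompleteSpace H] [CompleteSpace K] :
    (H →L[ℂ] H) →⋆ₙₐ[ℂ] (HTensor H K →L[ℂ] HTensor H K) where
  toFun S := opTensor S 1
  map_smul' c S := opTensor_smul_left c S 1
  map_zero' := by simpa using opTensor_smul_left (0 : ℂ) (0 : H →L[ℂ] H) (1 : K →L[ℂ] K)
  map_add' S S' := opTensor_add_left S S' 1
  map_mul' S S' := by rw [← opTensor_mul, one_mul]
  map_star' S := by rw [← opTensor_star, star_one]

/-- Bounded linear maps on a triple tensor product are determined by their values on
elementary tensors. -/
lemma htensor_ext₃ {E : Type*} [NormedAddCommGroup E] [NormedSpace ℂ E]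
    {f g : HTensor (HTensor H K) L →L[ℂ] E}
    (h : ∀ x y z, f (htmul (htmul x y) z) = g (htmul (htmul x y) z)) : f = g := by
  refine htensor_ext fun w z => ?_
  have : f.comp ((htmulL (HTensor H K) L).flip z) = g.comp ((htmulL (HTensor H K) L).flip z) :=
    htensor_ext fun x y => by simpa using h x y z
  simpa using DFunLike.congr_fun this w

lemma htensor_ext_right {E : Type*} [NormedAddCommGroup E] [NormedSpace ℂ E]
    {f g : HTensor H (HTensor K L) →L[ℂ] E}
    (h : ∀ x y z, f (htmul x (htmul y z)) = g (htmul x (htmul y z))) : f = g := by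
  refine htensor_ext fun x w => ?_
  have : f.comp (htmulL H (HTensor K L) x) = g.comp (htmulL H (HTensor K L) x) :=
    htensor_ext fun y z => by simpa using h x y z
  simpa using DFunLike.congr_fun this w

/-- `(h ⊗ k) ⊗ l ↦ (h ⊗ k) ⊗ l` from the algebraic tensor product. -/
def assocAux₁ : (H ⊗[ℂ] K) ⊗[ℂ] L →ₗ[ℂ] HTensor (HTensor H K) L :=
  (UniformSpace.Completion.toComplₗᵢ (𝕜 := ℂ)).toLinearMap ∘ₗ
    (TensorProduct.mapIsometry (𝕜 := ℂ) (UniformSpace.Completion.toComplₗᵢ (E := H ⊗[ℂ] K))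
      (LinearIsometry.id (E := L))).toLinearMap

/-- `h ⊗ (k ⊗ l) ↦ h ⊗ (k ⊗ l)` from the algebraic tensor product. -/
def assocAux₂ : H ⊗[ℂ] (K ⊗[ℂ] L) →ₗ[ℂ] HTensor H (HTensor K L) :=
  (UniformSpace.Completion.toComplₗᵢ (𝕜 := ℂ)).toLinearMap ∘ₗ
    (TensorProduct.mapIsometry (𝕜 := ℂ) (LinearIsometry.id (E := H))
      (UniformSpace.Completion.toComplₗᵢ (E := K ⊗[ℂ] L))).toLinearMap

lemma assocAux₁_tmul (h : H) (k : K) (l : L) :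
    assocAux₁ ((h ⊗ₜ[ℂ] k) ⊗ₜ[ℂ] l) = htmul (htmul h k) l := rfl

lemma assocAux₂_tmul (h : H) (k : K) (l : L) :
    assocAux₂ (h ⊗ₜ[ℂ] (k ⊗ₜ[ℂ] l)) = htmul h (htmul k l) := rfl

lemma norm_assocAux₁ (x : (H ⊗[ℂ] K) ⊗[ℂ] L) : ‖assocAux₁ x‖ = ‖x‖ := by
  simp only [assocAux₁, LinearMap.comp_apply, LinearIsometry.coe_toLinearMap,
    LinearIsometry.norm_map]

lemma norm_assocAux₂ (x : H ⊗[ℂ] (K ⊗[ℂ] L)) : ‖assocAux₂ x‖ = ‖x‖ := by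
  simp only [assocAux₂, LinearMap.comp_apply, LinearIsometry.coe_toLinearMap,
    LinearIsometry.norm_map]

lemma denseRange_assocAux₁ :
    DenseRange (assocAux₁ : (H ⊗[ℂ] K) ⊗[ℂ] L →ₗ[ℂ] HTensor (HTensor H K) L) := by
  set R := LinearMap.range (assocAux₁ : (H ⊗[ℂ] K) ⊗[ℂ] L →ₗ[ℂ] HTensor (HTensor H K) L)
    with hR
  suffices hT : R.topologicalClosure = ⊤ from
    Submodule.dense_iff_topologicalClosure_eq_top.mpr hT
  rw [eq_top_iff, ← span_htmul_dense (HTensor H K) L]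
  refine Submodule.topologicalClosure_minimal _ ?_ R.isClosed_topologicalClosure
  rw [Submodule.span_le]
  rintro _ ⟨⟨w, l⟩, rfl⟩
  induction w using UniformSpace.Completion.induction_on with
  | hp =>
    exact R.isClosed_topologicalClosure.preimage
      (f := fun w => htmul w l) ((htmulL (HTensor H K) L).flip l).continuous
  | ih x =>
    exact R.le_topologicalClosure ⟨x ⊗ₜ l, rfl⟩

lemma denseRange_assocAux₂ :
    DenseRange (assocAux₂ : H ⊗[ℂ] (K ⊗[ℂ] L) →ₗ[ℂ] HTensor H (HTensor K L)) := by
  set R := LinearMap.range (assocAux₂ : H ⊗[ℂ] (K ⊗[ℂ] L) →ₗ[ℂ] HTensor H (HTensor K L))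
    with hR
  suffices hT : R.topologicalClosure = ⊤ from
    Submodule.dense_iff_topologicalClosure_eq_top.mpr hT
  rw [eq_top_iff, ← span_htmul_dense H (HTensor K L)]
  refine Submodule.topologicalClosure_minimal _ ?_ R.isClosed_topologicalClosure
  rw [Submodule.span_le]
  rintro _ ⟨⟨h, w⟩, rfl⟩
  induction w using UniformSpace.Completion.induction_on with
  | hp =>
    exact R.isClosed_topologicalClosure.preimage
      (f := fun w => htmul h w) (htmulL H (HTensor K L) h).continuous
  | ih x =>
    exact R.le_topologicalClosure ⟨h ⊗ₜ x, rfl⟩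

variable (H K L) in
/-- The associativity unitary `(h ⊗ k) ⊗ l ↦ h ⊗ (k ⊗ l)`. -/
def htensorAssoc : HTensor (HTensor H K) L ≃ₗᵢ[ℂ] HTensor H (HTensor K L) :=
  (TensorProduct.assoc ℂ H K L).extendOfIsometry assocAux₁ assocAux₂
    denseRange_assocAux₁ denseRange_assocAux₂ (fun x => by
      rw [norm_assocAux₁, norm_assocAux₂]
      exact (TensorProduct.assocIsometry ℂ H K L).norm_map x)

@[simp] lemma htensorAssoc_htmul (h : H) (k : K) (l : L) :
    htensorAssoc H K L (htmul (htmul h k) l) = htmul h (htmul k l) := by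
  rw [← assocAux₁_tmul, htensorAssoc, LinearEquiv.extendOfIsometry_eq]
  rfl

@[simp] lemma htensorAssoc_symm_htmul (h : H) (k : K) (l : L) :
    (htensorAssoc H K L).symm (htmul h (htmul k l)) = htmul (htmul h k) l := by
  rw [LinearIsometryEquiv.symm_apply_eq, htensorAssoc_htmul]

end HilbertTensor

/-! ### Extension of nondegenerate representations to multipliers -/

section Extension

variable {B : Type v} [NonUnitalCStarAlgebra B] {H : Type w} [NormedAddCommGroup H]
  [InnerProductSpace ℂ H] [CompleteSpace H]

/-- A star representation of a C⋆-algebra `B` on a Hilbert space `H` is nondegenerate if the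
linear span of the vectors `θ b h` is dense in `H`. -/
def IsNondegenerateRep (θ : B →⋆ₙₐ[ℂ] (H →L[ℂ] H)) : Prop :=
  (Submodule.span ℂ (Set.range fun p : B × H => θ p.1 p.2)).topologicalClosure = ⊤

/-- The linear map `b ⊗ h ↦ θ (m b) h` on the algebraic tensor product. -/
def actionAux (θ : B →⋆ₙₐ[ℂ] (H →L[ℂ] H)) (m : 𝓜(ℂ, B)) : B ⊗[ℂ] H →ₗ[ℂ] H :=
  TensorProduct.lift (LinearMap.mk₂ ℂ (fun b h => θ (m.fst b) h)
    (fun b b' h => by simp) (fun c b h => by simp)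
    (fun b h h' => by simp) (fun c b h => by simp))

@[simp] lemma actionAux_tmul (θ : B →⋆ₙₐ[ℂ] (H →L[ℂ] H)) (m : 𝓜(ℂ, B)) (b : B) (h : H) :
    actionAux θ m (b ⊗ₜ h) = θ (m.fst b) h := rfl

lemma inner_rep (θ : B →⋆ₙₐ[ℂ] (H →L[ℂ] H)) (b c : B) (h k : H) :
    inner ℂ (θ b h) (θ c k) = inner ℂ h (θ (star b * c) k) := by
  rw [map_mul, map_star, ContinuousLinearMap.star_eq_adjoint,
    mul_apply_eq_comp, ContinuousLinearMap.adjoint_inner_right]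

lemma actionAux_inner (θ : B →⋆ₙₐ[ℂ] (H →L[ℂ] H)) (m n : 𝓜(ℂ, B)) (x y : B ⊗[ℂ] H) :
    inner ℂ (actionAux θ m x) (actionAux θ n y) =
      inner ℂ (actionAux θ 1 x) (actionAux θ (star m * n) y) := by
  induction x using TensorProduct.induction_on with
  | zero => simp
  | add x x' hx hx' => simp only [map_add, inner_add_left, hx, hx']
  | tmul b h =>
    induction y using TensorProduct.induction_on with
    | zero => simp
    | add y y' hy hy' => simp only [map_add, inner_add_right, hy, hy']
    | tmul c k =>
      have key : star (m.fst b) * n.fst c = star b * (star m * n).fst c := by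
        have := (star m).central (star b) (n.fst c)
        rw [DoubleCentralizer.star_snd, star_star] at this
        rw [this]; rfl
      simp only [actionAux_tmul]
      rw [inner_rep, key, ← inner_rep]
      rfl

lemma norm_actionAux_le (θ : B →⋆ₙₐ[ℂ] (H →L[ℂ] H)) (m : 𝓜(ℂ, B)) (x : B ⊗[ℂ] H) :
    ‖actionAux θ m x‖ ≤ ‖m‖ * ‖actionAux θ 1 x‖ := by
  let _ : PartialOrder 𝓜(ℂ, B) := CStarAlgebra.spectralOrder _
  let _ : StarOrderedRing 𝓜(ℂ, B) := CStarAlgebra.spectralOrderedRing _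
  obtain ⟨n, hn⟩ := CStarAlgebra.nonneg_iff_eq_star_mul_self.mp
    (sub_nonneg.mpr (CStarAlgebra.star_mul_le_algebraMap_norm_sq (a := m)))
  have hsub : actionAux θ (star n * n) x =
      ((‖m‖ ^ 2 : ℝ) : ℂ) • actionAux θ 1 x - actionAux θ (star m * m) x := by
    rw [← hn]
    induction x using TensorProduct.induction_on with
    | zero => simp
    | add x y hx hy => simp only [map_add, hx, hy, smul_add]; abel
    | tmul b h =>
      simp only [actionAux_tmul, DoubleCentralizer.sub_fst, Algebra.algebraMap_eq_smul_one]
      rw [Complex.coe_smul, sub_apply, map_sub, sub_apply]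
      congr 1
      rw [← Complex.coe_smul, ← Complex.coe_smul]
      simp
  have h1 := actionAux_inner θ n n x x
  have h2 := actionAux_inner θ m m x x
  rw [hsub, inner_sub_right, inner_smul_right, ← h2, inner_self_eq_norm_sq_to_K,
    inner_self_eq_norm_sq_to_K, inner_self_eq_norm_sq_to_K] at h1
  have h3 : ‖actionAux θ n x‖ ^ 2 = ‖m‖ ^ 2 * ‖actionAux θ 1 x‖ ^ 2 - ‖actionAux θ m x‖ ^ 2 := by
    apply Complex.ofReal_injective
    push_cast at h1 ⊢
    exact h1
  refine le_of_sq_le_sq ?_ (by positivity)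
  rw [mul_pow]
  linarith [sq_nonneg ‖actionAux θ n x‖]

/-- The canonical extension of a nondegenerate representation `θ` of `B` to a unital
representation of the multiplier algebra of `B`; it is determined by
`θ' m (θ b h) = θ (m b) h`. -/
def extendOp (θ : B →⋆ₙₐ[ℂ] (H →L[ℂ] H)) (m : 𝓜(ℂ, B)) : H →L[ℂ] H :=
  (actionAux θ m).extendOfNorm (actionAux θ 1)

variable {θ : B →⋆ₙₐ[ℂ] (H →L[ℂ] H)}

lemma denseRange_actionAux (hθ : IsNondegenerateRep θ) : DenseRange (actionAux θ 1) := by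
  have h1 : Dense ((Submodule.span ℂ (Set.range fun p : B × H => θ p.1 p.2) : Submodule ℂ H)
      : Set H) := Submodule.dense_iff_topologicalClosure_eq_top.mpr hθ
  refine h1.mono ?_
  have : Submodule.span ℂ (Set.range fun p : B × H => θ p.1 p.2) ≤
      LinearMap.range (actionAux θ 1) := by
    rw [Submodule.span_le]
    rintro _ ⟨⟨b, h⟩, rfl⟩
    exact ⟨b ⊗ₜ h, rfl⟩
  exact this

lemma extendOp_apply (hθ : IsNondegenerateRep θ) (m : 𝓜(ℂ, B)) (b : B) (h : H) :
    extendOp θ m (θ b h) = θ (m.fst b) h := by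
  have := LinearMap.extendOfNorm_eq (f := actionAux θ m) (denseRange_actionAux hθ)
    ⟨‖m‖, norm_actionAux_le θ m⟩ (b ⊗ₜ h)
  exact this

lemma ext_of_nondegenerate (hθ : IsNondegenerateRep θ) {S T : H →L[ℂ] H}
    (h : ∀ b x, S (θ b x) = T (θ b x)) : S = T := by
  refine ContinuousLinearMap.ext_on
    (s := Set.range fun p : B × H => θ p.1 p.2) ?_ ?_
  · rw [Submodule.dense_iff_topologicalClosure_eq_top]
    exact hθ
  · rintro _ ⟨p, rfl⟩
    exact h _ _

/-- The canonical extension of a nondegenerate representation to the multiplier algebra, as a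
unital star homomorphism. -/
def extendRep (θ : B →⋆ₙₐ[ℂ] (H →L[ℂ] H)) (hθ : IsNondegenerateRep θ) :
    𝓜(ℂ, B) →⋆ₐ[ℂ] (H →L[ℂ] H) where
  toFun := extendOp θ
  map_one' := ext_of_nondegenerate hθ fun b x => by rw [extendOp_apply hθ]; rfl
  map_mul' m n := ext_of_nondegenerate hθ fun b x => by
    simp [extendOp_apply hθ]
  map_zero' := ext_of_nondegenerate hθ fun b x => by simp [extendOp_apply hθ]
  map_add' m n := ext_of_nondegenerate hθ fun b x => by simp [extendOp_apply hθ]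
  commutes' c := ext_of_nondegenerate hθ fun b x => by
    simp [extendOp_apply hθ, Algebra.algebraMap_eq_smul_one]
  map_star' m := by
    rw [ContinuousLinearMap.star_eq_adjoint, ContinuousLinearMap.eq_adjoint_iff]
    intro x y
    refine (denseRange_actionAux hθ).induction_on₂
      (p := fun x y => inner ℂ (extendOp θ (star m) x) y = inner ℂ x (extendOp θ m y))
      (isClosed_eq (((extendOp θ (star m)).continuous.comp continuous_fst).inner continuous_snd)
        (continuous_fst.inner ((extendOp θ m).continuous.comp continuous_snd))) (fun z w => ?_) x y
    rw [extendOp, extendOp, LinearMap.extendOfNorm_eq (denseRange_actionAux hθ)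
      ⟨_, norm_actionAux_le θ _⟩, LinearMap.extendOfNorm_eq (denseRange_actionAux hθ)
      ⟨_, norm_actionAux_le θ _⟩, actionAux_inner, star_star, mul_one]

lemma extendRep_apply (hθ : IsNondegenerateRep θ) (m : 𝓜(ℂ, B)) (b : B) (h : H) :
    extendRep θ hθ m (θ b h) = θ (m.fst b) h :=
  extendOp_apply hθ m b h

lemma extendRep_mul (hθ : IsNondegenerateRep θ) (m : 𝓜(ℂ, B)) (b : B) :
    extendRep θ hθ m * θ b = θ (m.fst b) :=
  ContinuousLinearMap.ext fun h => extendOp_apply hθ m b h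

lemma extendRep_coe (hθ : IsNondegenerateRep θ) (b : B) :
    extendRep θ hθ (b : 𝓜(ℂ, B)) = θ b :=
  ext_of_nondegenerate hθ fun c x => by
    rw [extendRep_apply hθ]
    simp

/-- `extendRep` as a non-unital star homomorphism. -/
def extendHom (θ : B →⋆ₙₐ[ℂ] (H →L[ℂ] H)) (hθ : IsNondegenerateRep θ) :
    𝓜(ℂ, B) →⋆ₙₐ[ℂ] (H →L[ℂ] H) :=
  (extendRep θ hθ).toNonUnitalStarAlgHom

lemma extendHom_apply (hθ : IsNondegenerateRep θ) (m : 𝓜(ℂ, B)) (b : B) (h : H) :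
    extendHom θ hθ m (θ b h) = θ (m.fst b) h :=
  extendOp_apply hθ m b h

lemma extendHom_mul (hθ : IsNondegenerateRep θ) (m : 𝓜(ℂ, B)) (b : B) :
    extendHom θ hθ m * θ b = θ (m.fst b) :=
  extendRep_mul hθ m b

lemma extendHom_coe (hθ : IsNondegenerateRep θ) (b : B) :
    extendHom θ hθ (b : 𝓜(ℂ, B)) = θ b :=
  extendRep_coe hθ b

/-- The bounded linear map `b ↦ θ b h`. -/
def repVec (θ : B →⋆ₙₐ[ℂ] (H →L[ℂ] H)) (h : H) : B →L[ℂ] H :=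
  LinearMap.mkContinuous
    { toFun := fun b => θ b h
      map_add' := fun b c => by simp
      map_smul' := fun r b => by simp } ‖h‖
    (fun b => ((θ b).le_opNorm h).trans (by
      rw [mul_comm]
      gcongr
      exact NonUnitalStarAlgHom.norm_apply_le θ b))

@[simp] lemma repVec_apply (θ : B →⋆ₙₐ[ℂ] (H →L[ℂ] H)) (h : H) (b : B) :
    repVec θ h b = θ b h := rfl

/-- Conjugation by a unitary as a star homomorphism. -/
def conjHom {K : Type u} [NormedAddCommGroup K] [InnerProductSpace ℂ K] [CompleteSpace K]
    (U : H ≃ₗᵢ[ℂ] K) : (H →L[ℂ] H) →⋆ₙₐ[ℂ] (K →L[ℂ] K) where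
  toFun := U.conjStarAlgEquiv
  map_smul' := map_smul U.conjStarAlgEquiv
  map_zero' := map_zero U.conjStarAlgEquiv
  map_add' := map_add U.conjStarAlgEquiv
  map_mul' := map_mul U.conjStarAlgEquiv
  map_star' := map_star U.conjStarAlgEquiv

lemma conjHom_apply {K : Type u} [NormedAddCommGroup K] [InnerProductSpace ℂ K] [CompleteSpace K]
    (U : H ≃ₗᵢ[ℂ] K) (T : H →L[ℂ] H) (k : K) : conjHom U T k = U (T (U.symm k)) := rfl

end Extension

/-! ### Families of operators and multipliers -/

section Families

variable {B : Type v} [NonUnitalCStarAlgebra B] {ι : Type w} {C : ι → Type u}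
  [∀ i, NonUnitalCStarAlgebra (C i)]

variable (C) in
/-- The C⋆-algebra of bounded families, with the supremum norm. -/
def BddFamily : Type (max u w) := lp C ∞

instance : NonUnitalCStarAlgebra (BddFamily C) := inferInstanceAs (NonUnitalCStarAlgebra (lp C ∞))

instance : CoeFun (BddFamily C) fun _ => ∀ i, C i := ⟨fun x => x.1⟩

lemma BddFamily.ext {x y : BddFamily C} (h : ∀ i, x i = y i) : x = y := lp.ext (funext h)

/-- A family of star homomorphisms of C⋆-algebras, as a star homomorphism into the C⋆-algebra
of bounded families. -/
def familyHom (f : ∀ i, B →⋆ₙₐ[ℂ] C i) : B →⋆ₙₐ[ℂ] BddFamily C where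
  toFun b := ⟨fun i => f i b, memℓp_infty ⟨‖b‖, by
    rintro _ ⟨i, rfl⟩
    exact NonUnitalStarAlgHom.norm_apply_le (f i) b⟩⟩
  map_smul' c b := BddFamily.ext fun i => map_smul (f i) c b
  map_zero' := BddFamily.ext fun i => map_zero (f i)
  map_add' b b' := BddFamily.ext fun i => map_add (f i) b b'
  map_mul' b b' := BddFamily.ext fun i => map_mul (f i) b b'
  map_star' b := BddFamily.ext fun i => map_star (f i) b

@[simp] lemma familyHom_apply (f : ∀ i, B →⋆ₙₐ[ℂ] C i) (b : B) (i : ι) :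
    familyHom f b i = f i b := rfl

/-- Evaluation of a bounded family at an index. -/
def evalHom (i : ι) : BddFamily C →⋆ₙₐ[ℂ] C i where
  toFun x := x i
  map_smul' _ _ := rfl
  map_zero' := rfl
  map_add' _ _ := rfl
  map_mul' _ _ := rfl
  map_star' _ := rfl

@[simp] lemma evalHom_apply (i : ι) (x : BddFamily C) : evalHom i x = x i := rfl

end Families

section Idealizer

variable {B : Type v} [NonUnitalCStarAlgebra B] {D : Type w} [NonUnitalCStarAlgebra D]
  (T : NonUnitalStarSubalgebra ℂ D) [IsClosed (T : Set D)]

/-- A star homomorphism `F` into a C⋆-algebra `D` whose image multiplies the closed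
star subalgebra `T` into itself induces a star homomorphism into the multiplier algebra of `T`:
`F b` acts on `T` by multiplication. -/
def multiplierHom (F : B →⋆ₙₐ[ℂ] D) (hF : ∀ b, ∀ t ∈ T, F b * t ∈ T) : B →⋆ₙₐ[ℂ] 𝓜(ℂ, T) :=
  have hF' : ∀ b, ∀ t ∈ T, t * F b ∈ T := fun b t ht => by
    have := star_mem (hF (star b) (star t) (star_mem ht))
    rwa [star_mul, star_star, map_star, star_star] at this
  { toFun := fun b =>
      { fst := LinearMap.mkContinuous
          { toFun := fun t => ⟨F b * t, hF b t t.2⟩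
            map_add' := fun s t => Subtype.ext (mul_add _ _ _)
            map_smul' := fun c t => Subtype.ext (mul_smul_comm c (F b) (t : D)) } ‖F b‖
          (fun t => norm_mul_le (F b) (t : D))
        snd := LinearMap.mkContinuous
          { toFun := fun t => ⟨t * F b, hF' b t t.2⟩
            map_add' := fun s t => Subtype.ext (add_mul _ _ _)
            map_smul' := fun c t => Subtype.ext (smul_mul_assoc c (t : D) (F b)) } ‖F b‖
          (fun t => (norm_mul_le (t : D) (F b)).trans (mul_comm _ _).le)
        central := fun s t => Subtype.ext (mul_assoc _ _ _) }
    map_smul' := fun c b => DoubleCentralizer.ext _ _ _ _ <| Prod.ext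
      (ContinuousLinearMap.ext fun t => Subtype.ext <| by
        change F (c • b) * (t : D) = c • (F b * t)
        rw [map_smul, smul_mul_assoc])
      (ContinuousLinearMap.ext fun t => Subtype.ext <| by
        change (t : D) * F (c • b) = c • (t * F b)
        rw [map_smul, mul_smul_comm])
    map_zero' := DoubleCentralizer.ext _ _ _ _ <| Prod.ext
      (ContinuousLinearMap.ext fun t => Subtype.ext <| by
        change F 0 * (t : D) = 0
        rw [map_zero, zero_mul])
      (ContinuousLinearMap.ext fun t => Subtype.ext <| by
        change (t : D) * F 0 = 0
        rw [map_zero, mul_zero])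
    map_add' := fun b c => DoubleCentralizer.ext _ _ _ _ <| Prod.ext
      (ContinuousLinearMap.ext fun t => Subtype.ext <| by
        change F (b + c) * (t : D) = F b * t + F c * t
        rw [map_add, add_mul])
      (ContinuousLinearMap.ext fun t => Subtype.ext <| by
        change (t : D) * F (b + c) = t * F b + t * F c
        rw [map_add, mul_add])
    map_mul' := fun b c => DoubleCentralizer.ext _ _ _ _ <| Prod.ext
      (ContinuousLinearMap.ext fun t => Subtype.ext <| by
        change F (b * c) * (t : D) = F b * (F c * t)
        rw [map_mul, mul_assoc])
      (ContinuousLinearMap.ext fun t => Subtype.ext <| by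
        change (t : D) * F (b * c) = t * F b * F c
        rw [map_mul, mul_assoc])
    map_star' := fun b => DoubleCentralizer.ext _ _ _ _ <| Prod.ext
      (ContinuousLinearMap.ext fun t => Subtype.ext <| by
        change F (star b) * (t : D) = star (star (t : D) * F b)
        rw [map_star, star_mul, star_star])
      (ContinuousLinearMap.ext fun t => Subtype.ext <| by
        change (t : D) * F (star b) = star (F b * star (t : D))
        rw [map_star, star_mul, star_star]) }

variable {T}

@[simp] lemma coe_multiplierHom_fst (F : B →⋆ₙₐ[ℂ] D) (hF : ∀ b, ∀ t ∈ T, F b * t ∈ T)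
    (b : B) (t : T) : ((multiplierHom T F hF b).fst t : D) = F b * t := rfl

@[simp] lemma coe_multiplierHom_snd (F : B →⋆ₙₐ[ℂ] D) (hF : ∀ b, ∀ t ∈ T, F b * t ∈ T)
    (b : B) (t : T) : ((multiplierHom T F hF b).snd t : D) = t * F b := rfl

end Idealizer

/-! ### The minimal tensor products `A ⊗ A` and `A ⊗ A ⊗ A` -/

section MinTensor

variable (A : Type u) [NonUnitalCStarAlgebra A]

/-- A nondegenerate star representation of the C⋆-algebra `A` on a Hilbert space. -/
structure HilbertRep where
  /-- the Hilbert space -/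
  space : Type u
  [normed : NormedAddCommGroup space]
  [inner : InnerProductSpace ℂ space]
  [complete : CompleteSpace space]
  /-- the representation -/
  hom : A →⋆ₙₐ[ℂ] (space →L[ℂ] space)
  nondeg : IsNondegenerateRep hom

attribute [instance] HilbertRep.normed HilbertRep.inner HilbertRep.complete

/-- Bounded families of operators on `H ⊗ K`, indexed by all pairs of nondegenerate
representations of `A` on Hilbert spaces `H`, `K`. -/
def Ops₂ : Type (u + 1) := BddFamily (fun i : HilbertRep A × HilbertRep A =>
  HTensor i.1.space i.2.space →L[ℂ] HTensor i.1.space i.2.space)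

/-- Bounded families of operators on `H ⊗ K ⊗ L`, indexed by all triples of nondegenerate
representations of `A` on Hilbert spaces `H`, `K`, `L`. -/
def Ops₃ : Type (u + 1) := BddFamily (fun i : (HilbertRep A × HilbertRep A) × HilbertRep A =>
  HTensor (HTensor i.1.1.space i.1.2.space) i.2.space →L[ℂ]
    HTensor (HTensor i.1.1.space i.1.2.space) i.2.space)

instance : NonUnitalCStarAlgebra (Ops₂ A) := inferInstanceAs (NonUnitalCStarAlgebra (BddFamily _))

instance : NonUnitalCStarAlgebra (Ops₃ A) := inferInstanceAs (NonUnitalCStarAlgebra (BddFamily _))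

variable {A}

/-- The family of operators `π a ⊗ ρ b`. -/
def elem₂ (a b : A) : Ops₂ A :=
  ⟨fun i => opTensor (i.1.hom a) (i.2.hom b), memℓp_infty ⟨‖a‖ * ‖b‖, by
    rintro _ ⟨i, rfl⟩
    refine (opTensor_norm_le _ _).trans ?_
    gcongr <;> exact NonUnitalStarAlgHom.norm_apply_le _ _⟩⟩

/-- The family of operators `π a ⊗ ρ b ⊗ σ c`. -/
def elem₃ (a b c : A) : Ops₃ A :=
  ⟨fun i => opTensor (opTensor (i.1.1.hom a) (i.1.2.hom b)) (i.2.hom c),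
    memℓp_infty ⟨‖a‖ * ‖b‖ * ‖c‖, by
      rintro _ ⟨i, rfl⟩
      refine (opTensor_norm_le _ _).trans ?_
      gcongr
      · refine (opTensor_norm_le _ _).trans ?_
        gcongr <;> exact NonUnitalStarAlgHom.norm_apply_le _ _
      · exact NonUnitalStarAlgHom.norm_apply_le _ _⟩⟩

variable (A)

/-- The C⋆-algebra of operator families generated by the elementary tensors `a ⊗ b`. -/
def minTensorSubalgebra : NonUnitalStarSubalgebra ℂ (Ops₂ A) :=
  (NonUnitalStarAlgebra.adjoin ℂ (Set.range fun p : A × A => elem₂ p.1 p.2)).topologicalClosure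

/-- The C⋆-algebra of operator families generated by the elementary tensors `a ⊗ b ⊗ c`. -/
def minTensorSubalgebra₃ : NonUnitalStarSubalgebra ℂ (Ops₃ A) :=
  (NonUnitalStarAlgebra.adjoin ℂ
    (Set.range fun p : (A × A) × A => elem₃ p.1.1 p.1.2 p.2)).topologicalClosure

instance : IsClosed (minTensorSubalgebra A : Set (Ops₂ A)) :=
  NonUnitalStarSubalgebra.isClosed_topologicalClosure _

instance : IsClosed (minTensorSubalgebra₃ A : Set (Ops₃ A)) :=
  NonUnitalStarSubalgebra.isClosed_topologicalClosure _

/-- The minimal (spatial) C⋆-tensor product `A ⊗ A`: the completion of the algebraic tensor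
product in the norm `‖∑ aₖ ⊗ bₖ‖ = sup ‖∑ π aₖ ⊗ ρ bₖ‖`, the supremum being over all pairs of
nondegenerate representations `π`, `ρ` of `A` on Hilbert spaces. -/
abbrev MinTensor := minTensorSubalgebra A

/-- The minimal (spatial) C⋆-tensor product `A ⊗ A ⊗ A`. -/
abbrev MinTensor₃ := minTensorSubalgebra₃ A

end MinTensor

/-! ### Density arguments -/

section Density

variable {X Y : Type*} [NormedAddCommGroup X] [NormedSpace ℂ X]
  [NormedAddCommGroup Y] [NormedSpace ℂ Y]

lemma map_mem_of_mem_closure_span (f : X →L[ℂ] Y) {S : Set X} {N : Submodule ℂ Y}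
    (hN : IsClosed (N : Set Y)) (hf : ∀ s ∈ S, f s ∈ N) {x : X}
    (hx : x ∈ (Submodule.span ℂ S).topologicalClosure) : f x ∈ N := by
  have h : (Submodule.span ℂ S).topologicalClosure ≤ N.comap f.toLinearMap :=
    Submodule.topologicalClosure_minimal _ (Submodule.span_le.mpr hf)
      (hN.preimage f.continuous)
  exact h hx

variable {B : Type v} [NonUnitalCStarAlgebra B] {D : Type w} [NonUnitalCStarAlgebra D]

/-- A star homomorphism of C⋆-algebras as a bounded linear map. -/
def homCLM (F : B →⋆ₙₐ[ℂ] D) : B →L[ℂ] D :=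
  LinearMap.mkContinuous { toFun := F, map_add' := map_add F, map_smul' := map_smul F } 1
    (fun b => by simpa using NonUnitalStarAlgHom.norm_apply_le F b)

@[simp] lemma homCLM_apply (F : B →⋆ₙₐ[ℂ] D) (b : B) : homCLM F b = F b := rfl

lemma adjoin_closure_le_span_closure {S : Set D} (hmul : ∀ s ∈ S, ∀ t ∈ S, s * t ∈ S)
    (hstar : ∀ s ∈ S, star s ∈ S) {x : D}
    (hx : x ∈ (NonUnitalStarAlgebra.adjoin ℂ S).topologicalClosure) :
    x ∈ (Submodule.span ℂ S).topologicalClosure := by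
  refine closure_mono (s := (NonUnitalStarAlgebra.adjoin ℂ S : Set D))
    (t := (Submodule.span ℂ S : Set D)) ?_ hx
  intro y hy
  have hmul' : ∀ a ∈ Submodule.span ℂ S, ∀ b ∈ Submodule.span ℂ S,
      a * b ∈ Submodule.span ℂ S := by
    intro a ha b hb
    induction ha, hb using Submodule.span_induction₂ with
    | mem_mem a b ha hb => exact Submodule.subset_span (hmul a ha b hb)
    | zero_left b _ => simp
    | zero_right b _ => simp
    | add_left a b c _ _ _ h1 h2 => rw [add_mul]; exact add_mem h1 h2
    | add_right a b c _ _ _ h1 h2 => rw [mul_add]; exact add_mem h1 h2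
    | smul_left r a b _ _ h => rw [smul_mul_assoc]; exact Submodule.smul_mem _ _ h
    | smul_right r a b _ _ h => rw [mul_smul_comm]; exact Submodule.smul_mem _ _ h
  have hstar' : ∀ a ∈ Submodule.span ℂ S, star a ∈ Submodule.span ℂ S := by
    intro a ha
    induction ha using Submodule.span_induction with
    | mem a ha => exact Submodule.subset_span (hstar a ha)
    | zero => simp
    | add a b _ _ h1 h2 => rw [star_add]; exact add_mem h1 h2
    | smul r a _ h => rw [star_smul]; exact Submodule.smul_mem _ _ h
  rw [SetLike.mem_coe] at hy ⊢
  induction hy using NonUnitalStarAlgebra.adjoin_induction with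
  | mem a ha => exact Submodule.subset_span ha
  | add a b _ _ h1 h2 => exact add_mem h1 h2
  | zero => exact zero_mem _
  | mul a b _ _ h1 h2 => exact hmul' a h1 b h2
  | smul r a _ h => exact Submodule.smul_mem _ r h
  | star a _ h => exact hstar' a h

lemma mul_self_dense : (Submodule.span ℂ (Set.range fun p : B × B => p.1 * p.2)).topologicalClosure
    = ⊤ := by
  rw [eq_top_iff]
  rintro c -
  let _ : PartialOrder B := CStarAlgebra.spectralOrder B
  let _ : StarOrderedRing B := CStarAlgebra.spectralOrderedRing B
  have := (CStarAlgebra.increasingApproximateUnit B).tendsto_mul_left c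
  refine mem_closure_of_tendsto this (Filter.Eventually.of_forall fun e => ?_)
  exact Submodule.subset_span ⟨(_, _), rfl⟩

end Density

/-- A star homomorphism `φ` from `A` to the multiplier algebra of `B` is nondegenerate if the
linear span of the elements `φ a * b` is dense in `B`. -/
def IsNondegenerateHom {A : Type u} [NonUnitalCStarAlgebra A] {B : Type v} [NonUnitalCStarAlgebra B]
    (φ : A →⋆ₙₐ[ℂ] 𝓜(ℂ, B)) : Prop :=
  (Submodule.span ℂ (Set.range fun p : A × B => (φ p.1).fst p.2)).topologicalClosure = ⊤

lemma fst_mul {B : Type v} [NonUnitalCStarAlgebra B] (x : 𝓜(ℂ, B)) (y t : B) :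
    x.fst (y * t) = x.fst y * t := by
  rw [← sub_eq_zero, ← CStarRing.star_mul_self_eq_zero_iff, mul_sub, ← x.central, ← mul_assoc,
    ← mul_assoc, ← x.central, sub_self]

lemma multiplier_mul_coe {B : Type v} [NonUnitalCStarAlgebra B] (x : 𝓜(ℂ, B)) (y : B) :
    x * (y : 𝓜(ℂ, B)) = ((x.fst y : B) : 𝓜(ℂ, B)) :=
  DoubleCentralizer.ext _ _ _ _ <| Prod.ext
    (ContinuousLinearMap.ext fun t => fst_mul x y t)
    (ContinuousLinearMap.ext fun t => x.central t y)

/-- If `P w * Q c` are elements of `T` spanning a dense subspace and `F` is given on elementary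
tensors by `F (a ⊗ b) * (P w * Q c) = P (φ a * w) * Q (b * c)` then `F` multiplies `T` into
itself. -/
lemma leg_mul_mem {A : Type u} [NonUnitalCStarAlgebra A] {B : Type v} [NonUnitalCStarAlgebra B]
    {D : Type w} [NonUnitalCStarAlgebra D] (T : NonUnitalStarSubalgebra ℂ D)
    (hTc : IsClosed (T : Set D)) {φ : A →⋆ₙₐ[ℂ] 𝓜(ℂ, B)} (hφ : IsNondegenerateHom φ)
    (F : 𝓜(ℂ, B) →⋆ₙₐ[ℂ] D) (P : B →⋆ₙₐ[ℂ] D) (Q : A →⋆ₙₐ[ℂ] D) (e : A → A → B)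
    (he : (Submodule.span ℂ (Set.range fun p : A × A => e p.1 p.2)).topologicalClosure = ⊤)
    (hPQ : ∀ w c, P w * Q c ∈ T)
    (hT : ∀ t ∈ T, t ∈ (Submodule.span ℂ
      (Set.range fun p : B × A => P p.1 * Q p.2)).topologicalClosure)
    (hF : ∀ a b w c, F (e a b : 𝓜(ℂ, B)) * (P w * Q c) = P ((φ a).fst w) * Q (b * c))
    (x : 𝓜(ℂ, B)) (t : D) (ht : t ∈ T) : F x * t ∈ T := by
  set T' : Submodule ℂ D := T.toNonUnitalSubalgebra.toSubmodule with hT'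
  have hA : ∀ y : B, ∀ t ∈ T, F (y : 𝓜(ℂ, B)) * t ∈ T := by
    intro y t ht
    refine map_mem_of_mem_closure_span (N := T') (ContinuousLinearMap.mul ℂ D (F (y : 𝓜(ℂ, B))))
      hTc ?_ (hT t ht)
    rintro _ ⟨⟨w, c⟩, rfl⟩
    refine map_mem_of_mem_closure_span (N := T') (x := y) (((ContinuousLinearMap.mul ℂ D).flip (P w * Q c)).comp
      (homCLM (F.comp DoubleCentralizer.coeHom))) hTc ?_ (he ▸ Submodule.mem_top)
    rintro _ ⟨⟨a, b⟩, rfl⟩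
    change F (e a b : 𝓜(ℂ, B)) * (P w * Q c) ∈ T
    rw [hF]
    exact hPQ _ _
  set N : Submodule ℂ D := (Submodule.span ℂ
    (Set.range fun p : B × T => F (p.1 : 𝓜(ℂ, B)) * (p.2 : D))).topologicalClosure with hN
  have hNc : IsClosed (N : Set D) := Submodule.isClosed_topologicalClosure _
  have hB : ∀ w c, P w * Q c ∈ N := by
    intro w c
    refine map_mem_of_mem_closure_span (N := N) (x := c)
      ((ContinuousLinearMap.mul ℂ D (P w)).comp (homCLM Q)) hNc ?_
      (mul_self_dense (B := A) ▸ Submodule.mem_top)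
    rintro _ ⟨⟨b, c⟩, rfl⟩
    refine map_mem_of_mem_closure_span (N := N) (x := w)
      (((ContinuousLinearMap.mul ℂ D).flip (Q (b * c))).comp (homCLM P)) hNc ?_
      ((show _ = _ from hφ) ▸ Submodule.mem_top)
    rintro _ ⟨⟨a, w⟩, rfl⟩
    change P ((φ a).fst w) * Q (b * c) ∈ N
    rw [← hF]
    exact Submodule.le_topologicalClosure _ (Submodule.subset_span ⟨(e a b, ⟨_, hPQ w c⟩), rfl⟩)
  have hTN : t ∈ N := by
    refine map_mem_of_mem_closure_span (N := N) (ContinuousLinearMap.id ℂ D) hNc ?_ (hT t ht)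
    rintro _ ⟨⟨w, c⟩, rfl⟩
    exact hB w c
  refine map_mem_of_mem_closure_span (N := T') (ContinuousLinearMap.mul ℂ D (F x)) hTc ?_ hTN
  rintro _ ⟨⟨y, s⟩, rfl⟩
  change F x * (F (y : 𝓜(ℂ, B)) * (s : D)) ∈ T
  rw [← mul_assoc, ← map_mul, multiplier_mul_coe]
  exact hA _ _ s.2

section MinTensorMaps

variable {A : Type u} [NonUnitalCStarAlgebra A]

lemma elem₂_mul (a b c d : A) : elem₂ a b * elem₂ c d = elem₂ (a * c) (b * d) :=
  BddFamily.ext fun i => by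
    change opTensor _ _ * opTensor _ _ = opTensor _ _
    rw [← opTensor_mul, map_mul, map_mul]

lemma elem₂_star (a b : A) : star (elem₂ a b) = elem₂ (star a) (star b) :=
  BddFamily.ext fun i => by
    change star (opTensor _ _) = opTensor _ _
    rw [← opTensor_star, map_star, map_star]

lemma elem₃_mul (a b c a' b' c' : A) :
    elem₃ a b c * elem₃ a' b' c' = elem₃ (a * a') (b * b') (c * c') :=
  BddFamily.ext fun i => by
    change opTensor (opTensor _ _) _ * opTensor (opTensor _ _) _ = opTensor (opTensor _ _) _
    rw [← opTensor_mul, ← opTensor_mul, map_mul, map_mul, map_mul]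

lemma elem₃_star (a b c : A) : star (elem₃ a b c) = elem₃ (star a) (star b) (star c) :=
  BddFamily.ext fun i => by
    change star (opTensor (opTensor _ _) _) = opTensor (opTensor _ _) _
    rw [← opTensor_star, ← opTensor_star, map_star, map_star, map_star]

lemma elem₂_mem (a b : A) : elem₂ a b ∈ minTensorSubalgebra A :=
  NonUnitalStarSubalgebra.le_topologicalClosure _
    (NonUnitalStarAlgebra.subset_adjoin ℂ _ ⟨(a, b), rfl⟩)

lemma elem₃_mem (a b c : A) : elem₃ a b c ∈ minTensorSubalgebra₃ A :=
  NonUnitalStarSubalgebra.le_topologicalClosure _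
    (NonUnitalStarAlgebra.subset_adjoin ℂ _ ⟨((a, b), c), rfl⟩)

lemma minTensorSubalgebra_le_span {x : Ops₂ A} (hx : x ∈ minTensorSubalgebra A) :
    x ∈ (Submodule.span ℂ (Set.range fun p : A × A => elem₂ p.1 p.2)).topologicalClosure := by
  refine adjoin_closure_le_span_closure ?_ ?_ hx
  · rintro _ ⟨p, rfl⟩ _ ⟨q, rfl⟩
    exact ⟨(p.1 * q.1, p.2 * q.2), (elem₂_mul _ _ _ _).symm⟩
  · rintro _ ⟨p, rfl⟩
    exact ⟨(star p.1, star p.2), (elem₂_star _ _).symm⟩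

lemma minTensorSubalgebra₃_le_span {x : Ops₃ A} (hx : x ∈ minTensorSubalgebra₃ A) :
    x ∈ (Submodule.span ℂ
      (Set.range fun p : (A × A) × A => elem₃ p.1.1 p.1.2 p.2)).topologicalClosure := by
  refine adjoin_closure_le_span_closure ?_ ?_ hx
  · rintro _ ⟨p, rfl⟩ _ ⟨q, rfl⟩
    exact ⟨((p.1.1 * q.1.1, p.1.2 * q.1.2), p.2 * q.2), (elem₃_mul _ _ _ _ _ _).symm⟩
  · rintro _ ⟨p, rfl⟩
    exact ⟨((star p.1.1, star p.1.2), star p.2), (elem₃_star _ _ _).symm⟩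

/-- The elementary tensor `a ⊗ b` in the minimal tensor product `A ⊗ A`. -/
def tmul (a b : A) : MinTensor A := ⟨elem₂ a b, elem₂_mem a b⟩

@[simp] lemma coe_tmul (a b : A) : (tmul a b : Ops₂ A) = elem₂ a b := rfl

/-- The elementary tensor `a ⊗ b ⊗ c` in the minimal tensor product `A ⊗ A ⊗ A`. -/
def tmul₃ (a b c : A) : MinTensor₃ A := ⟨elem₃ a b c, elem₃_mem a b c⟩

lemma span_tmul_dense :
    (Submodule.span ℂ (Set.range fun p : A × A => tmul p.1 p.2)).topologicalClosure = ⊤ := by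
  rw [eq_top_iff]
  rintro x -
  have hx := minTensorSubalgebra_le_span x.2
  have himg : ((↑) : MinTensor A → Ops₂ A) ''
      (Submodule.span ℂ (Set.range fun p : A × A => tmul p.1 p.2) : Set (MinTensor A)) =
      (Submodule.span ℂ (Set.range fun p : A × A => elem₂ p.1 p.2) : Set (Ops₂ A)) := by
    let j : MinTensor A →ₗ[ℂ] Ops₂ A :=
      (minTensorSubalgebra A).toNonUnitalSubalgebra.toSubmodule.subtype
    change j '' _ = _
    rw [← Submodule.map_coe, Submodule.map_span, ← Set.range_comp]
    rfl
  change x ∈ closure _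
  rw [closure_subtype]
  change (x : Ops₂ A) ∈ closure (((↑) : MinTensor A → Ops₂ A) ''
    (Submodule.span ℂ (Set.range fun p : A × A => tmul p.1 p.2) : Set (MinTensor A)))
  rw [himg]
  exact hx

variable (A) in
/-- The inclusion of `A ⊗ A` into the algebra of operator families. -/
def minTensorIncl : MinTensor A →⋆ₙₐ[ℂ] Ops₂ A where
  toFun x := x
  map_smul' _ _ := rfl
  map_zero' := rfl
  map_add' _ _ := rfl
  map_mul' _ _ := rfl
  map_star' _ := rfl

/-- The representation `π ⊗ ρ` of the minimal tensor product `A ⊗ A` on `H ⊗ K`. -/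
def tensorRep (π ρ : HilbertRep A) :
    MinTensor A →⋆ₙₐ[ℂ] (HTensor π.space ρ.space →L[ℂ] HTensor π.space ρ.space) :=
  (evalHom (C := fun i : HilbertRep A × HilbertRep A =>
    HTensor i.1.space i.2.space →L[ℂ] HTensor i.1.space i.2.space) (π, ρ)).comp
    (minTensorIncl A)

@[simp] lemma tensorRep_tmul (π ρ : HilbertRep A) (a b : A) :
    tensorRep π ρ (tmul a b) = opTensor (π.hom a) (ρ.hom b) := rfl

lemma tensorRep_nondeg (π ρ : HilbertRep A) : IsNondegenerateRep (tensorRep π ρ) := by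
  set N : Submodule ℂ (HTensor π.space ρ.space) := (Submodule.span ℂ (Set.range
    fun p : MinTensor A × HTensor π.space ρ.space => tensorRep π ρ p.1 p.2)).topologicalClosure
    with hN
  have hNc : IsClosed (N : Set (HTensor π.space ρ.space)) := Submodule.isClosed_topologicalClosure _
  change N = ⊤
  rw [eq_top_iff]
  rintro z -
  refine map_mem_of_mem_closure_span (N := N) (x := z) (ContinuousLinearMap.id ℂ _) hNc ?_
    (span_htmul_dense π.space ρ.space ▸ Submodule.mem_top)
  rintro _ ⟨⟨h, k⟩, rfl⟩
  refine map_mem_of_mem_closure_span (N := N) (x := h)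
    ((htmulL π.space ρ.space).flip k) hNc ?_ ((show _ = _ from π.nondeg) ▸ Submodule.mem_top)
  rintro _ ⟨⟨a, h⟩, rfl⟩
  refine map_mem_of_mem_closure_span (N := N) (x := k)
    (htmulL π.space ρ.space (π.hom a h)) hNc ?_ ((show _ = _ from ρ.nondeg) ▸ Submodule.mem_top)
  rintro _ ⟨⟨b, k⟩, rfl⟩
  refine Submodule.le_topologicalClosure _ (Submodule.subset_span ⟨(tmul a b, htmul h k), ?_⟩)
  simp

/-! ### The multipliers `1 ⊗ b` and `a ⊗ 1` -/

lemma multiplier_mem_aux (T : Ops₂ A) (h : ∀ c d, T * elem₂ c d ∈ minTensorSubalgebra A) :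
    ∀ t ∈ minTensorSubalgebra A, T * t ∈ minTensorSubalgebra A := by
  intro t ht
  refine map_mem_of_mem_closure_span
    (N := (minTensorSubalgebra A).toNonUnitalSubalgebra.toSubmodule)
    (ContinuousLinearMap.mul ℂ (Ops₂ A) T)
    (inferInstance : IsClosed (minTensorSubalgebra A : Set (Ops₂ A))) ?_
    (minTensorSubalgebra_le_span ht)
  rintro _ ⟨⟨c, d⟩, rfl⟩
  exact h c d

/-- The family of operators `1 ⊗ ρ b`. -/
def rightLeg : A →⋆ₙₐ[ℂ] Ops₂ A :=
  familyHom fun i : HilbertRep A × HilbertRep A =>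
    (opTensorRight i.1.space i.2.space).comp i.2.hom

/-- The family of operators `π a ⊗ 1`. -/
def leftLeg : A →⋆ₙₐ[ℂ] Ops₂ A :=
  familyHom fun i : HilbertRep A × HilbertRep A =>
    (opTensorLeft i.1.space i.2.space).comp i.1.hom

lemma rightLeg_mul (b c d : A) : rightLeg b * elem₂ c d = elem₂ c (b * d) :=
  BddFamily.ext fun i => by
    change opTensor 1 (i.2.hom b) * opTensor _ _ = opTensor _ _
    rw [← opTensor_mul, one_mul, map_mul]

lemma leftLeg_mul (a c d : A) : leftLeg a * elem₂ c d = elem₂ (a * c) d :=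
  BddFamily.ext fun i => by
    change opTensor (i.1.hom a) 1 * opTensor _ _ = opTensor _ _
    rw [← opTensor_mul, one_mul, map_mul]

/-- The multiplier `1 ⊗ b` of `A ⊗ A`. -/
def oneTmul : A →⋆ₙₐ[ℂ] 𝓜(ℂ, MinTensor A) :=
  multiplierHom (minTensorSubalgebra A) rightLeg fun b => multiplier_mem_aux _ fun c d => by
    rw [rightLeg_mul]; exact elem₂_mem _ _

/-- The multiplier `a ⊗ 1` of `A ⊗ A`. -/
def tmulOne : A →⋆ₙₐ[ℂ] 𝓜(ℂ, MinTensor A) :=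
  multiplierHom (minTensorSubalgebra A) leftLeg fun b => multiplier_mem_aux _ fun c d => by
    rw [leftLeg_mul]; exact elem₂_mem _ _

lemma oneTmul_tmul (b c d : A) : (oneTmul b).fst (tmul c d) = tmul c (b * d) :=
  Subtype.ext (rightLeg_mul b c d)

lemma tmulOne_tmul (a c d : A) : (tmulOne a).fst (tmul c d) = tmul (a * c) d :=
  Subtype.ext (leftLeg_mul a c d)

/-! ### The homomorphisms `φ ⊗ ι` and `ι ⊗ φ` -/

section Slices

variable {φ : A →⋆ₙₐ[ℂ] 𝓜(ℂ, MinTensor A)}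

/-- The representation `a ↦ (π ⊗ ρ) (φ a)` of `A` on `H ⊗ K`, where `π ⊗ ρ` is extended to the
multiplier algebra of `A ⊗ A`. -/
abbrev convRep (hφ : IsNondegenerateHom φ) (π ρ : HilbertRep A) : HilbertRep A where
  space := HTensor π.space ρ.space
  hom := (extendHom (tensorRep π ρ) (tensorRep_nondeg π ρ)).comp φ
  nondeg := by
    set N : Submodule ℂ (HTensor π.space ρ.space) := (Submodule.span ℂ (Set.range
      fun p : A × HTensor π.space ρ.space =>
        extendHom (tensorRep π ρ) (tensorRep_nondeg π ρ) (φ p.1) p.2)).topologicalClosure with hN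
    have hNc : IsClosed (N : Set (HTensor π.space ρ.space)) :=
      Submodule.isClosed_topologicalClosure _
    change N = ⊤
    rw [eq_top_iff]
    rintro z -
    refine map_mem_of_mem_closure_span (N := N) (x := z) (ContinuousLinearMap.id ℂ _) hNc ?_
      ((show _ = _ from tensorRep_nondeg π ρ) ▸ Submodule.mem_top)
    rintro _ ⟨⟨x, z⟩, rfl⟩
    refine map_mem_of_mem_closure_span (N := N) (x := x)
      (repVec (tensorRep π ρ) z) hNc ?_
      ((show _ = _ from hφ) ▸ Submodule.mem_top)
    rintro _ ⟨⟨a, x⟩, rfl⟩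
    refine Submodule.le_topologicalClosure _ (Submodule.subset_span ⟨(a, tensorRep π ρ x z), ?_⟩)
    exact extendHom_apply (θ := tensorRep π ρ) (tensorRep_nondeg π ρ) (φ a) x z

lemma convRep_mul (hφ : IsNondegenerateHom φ) (π ρ : HilbertRep A) (a : A) (x : MinTensor A) :
    (convRep hφ π ρ).hom a * tensorRep π ρ x = tensorRep π ρ ((φ a).fst x) :=
  extendHom_mul (tensorRep_nondeg π ρ) (φ a) x

end Slices
end MinTensorMaps

section MinTensorMaps
variable {A : Type u} [NonUnitalCStarAlgebra A]
section Slices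
variable {φ : A →⋆ₙₐ[ℂ] 𝓜(ℂ, MinTensor A)}
/-- The family of operators `(π ⊗ ρ) x ⊗ 1`. -/
def leg₁₂ : MinTensor A →⋆ₙₐ[ℂ] Ops₃ A :=
  familyHom fun i : (HilbertRep A × HilbertRep A) × HilbertRep A =>
    (opTensorLeft (HTensor i.1.1.space i.1.2.space) i.2.space).comp (tensorRep i.1.1 i.1.2)

/-- The family of operators `1 ⊗ 1 ⊗ σ c`. -/
def leg₃ : A →⋆ₙₐ[ℂ] Ops₃ A :=
  familyHom fun i : (HilbertRep A × HilbertRep A) × HilbertRep A =>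
    (opTensorRight (HTensor i.1.1.space i.1.2.space) i.2.space).comp i.2.hom

/-- Transport of operators on `H ⊗ (K ⊗ L)` to operators on `(H ⊗ K) ⊗ L`. -/
def reassoc (H K L : Type u) [NormedAddCommGroup H] [InnerProductSpace ℂ H]
    [NormedAddCommGroup K] [InnerProductSpace ℂ K]
    [NormedAddCommGroup L] [InnerProductSpace ℂ L] :
    (HTensor H (HTensor K L) →L[ℂ] HTensor H (HTensor K L)) →⋆ₙₐ[ℂ]
      (HTensor (HTensor H K) L →L[ℂ] HTensor (HTensor H K) L) :=
  conjHom (htensorAssoc H K L).symm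

lemma reassoc_mul {H K L : Type u} [NormedAddCommGroup H] [InnerProductSpace ℂ H]
    [NormedAddCommGroup K] [InnerProductSpace ℂ K]
    [NormedAddCommGroup L] [InnerProductSpace ℂ L]
    (S T : HTensor H (HTensor K L) →L[ℂ] HTensor H (HTensor K L)) :
    reassoc H K L (S * T) = reassoc H K L S * reassoc H K L T :=
  map_mul (reassoc H K L) S T

lemma HilbertRep.hom_mul (π : HilbertRep A) (a b : A) : π.hom (a * b) = π.hom a * π.hom b :=
  map_mul π.hom a b

lemma reassoc_opTensor {H K L : Type u} [NormedAddCommGroup H] [InnerProductSpace ℂ H]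
    [NormedAddCommGroup K] [InnerProductSpace ℂ K]
    [NormedAddCommGroup L] [InnerProductSpace ℂ L]
    (R : H →L[ℂ] H) (S : K →L[ℂ] K) (T : L →L[ℂ] L) :
    reassoc H K L (opTensor R (opTensor S T)) = opTensor (opTensor R S) T := by
  refine htensor_ext₃ fun x y z => ?_
  rw [reassoc, conjHom_apply, LinearIsometryEquiv.symm_symm]
  simp

/-- The family of operators `1 ⊗ (ρ ⊗ σ) x`. -/
def leg₂₃ : MinTensor A →⋆ₙₐ[ℂ] Ops₃ A :=
  familyHom fun i : (HilbertRep A × HilbertRep A) × HilbertRep A =>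
    (reassoc i.1.1.space i.1.2.space i.2.space).comp
      ((opTensorRight i.1.1.space (HTensor i.1.2.space i.2.space)).comp (tensorRep i.1.2 i.2))

/-- The family of operators `π a ⊗ 1 ⊗ 1`. -/
def leg₁ : A →⋆ₙₐ[ℂ] Ops₃ A :=
  familyHom fun i : (HilbertRep A × HilbertRep A) × HilbertRep A =>
    (reassoc i.1.1.space i.1.2.space i.2.space).comp
      ((opTensorLeft i.1.1.space (HTensor i.1.2.space i.2.space)).comp i.1.1.hom)

/-- The operator at the index `i` of a family of operators. -/
def ev₃ (x : Ops₃ A) (i : (HilbertRep A × HilbertRep A) × HilbertRep A) :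
    HTensor (HTensor i.1.1.space i.1.2.space) i.2.space →L[ℂ]
      HTensor (HTensor i.1.1.space i.1.2.space) i.2.space :=
  (show BddFamily (fun i : (HilbertRep A × HilbertRep A) × HilbertRep A =>
    HTensor (HTensor i.1.1.space i.1.2.space) i.2.space →L[ℂ]
      HTensor (HTensor i.1.1.space i.1.2.space) i.2.space) from x) i

lemma ops₃_ext {x y : Ops₃ A} (h : ∀ i, ev₃ x i = ev₃ y i) : x = y := BddFamily.ext h

lemma ev₃_mul (x y : Ops₃ A) (i : (HilbertRep A × HilbertRep A) × HilbertRep A) : ev₃ (x * y) i = ev₃ x i * ev₃ y i := rfl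

lemma ev₃_elem₃ (a b c : A) (i : (HilbertRep A × HilbertRep A) × HilbertRep A) :
    ev₃ (elem₃ a b c) i = opTensor (opTensor (i.1.1.hom a) (i.1.2.hom b)) (i.2.hom c) := rfl

lemma ev₃_leg₁₂ (x : MinTensor A) (i : (HilbertRep A × HilbertRep A) × HilbertRep A) :
    ev₃ (leg₁₂ x) i = opTensor (tensorRep i.1.1 i.1.2 x) 1 := rfl

lemma ev₃_leg₃ (c : A) (i : (HilbertRep A × HilbertRep A) × HilbertRep A) : ev₃ (leg₃ c) i = opTensor 1 (i.2.hom c) := rfl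

lemma ev₃_leg₂₃ (x : MinTensor A) (i : (HilbertRep A × HilbertRep A) × HilbertRep A) :
    ev₃ (leg₂₃ x) i = reassoc i.1.1.space i.1.2.space i.2.space
      (opTensor 1 (tensorRep i.1.2 i.2 x)) := rfl

lemma ev₃_leg₁ (a : A) (i : (HilbertRep A × HilbertRep A) × HilbertRep A) :
    ev₃ (leg₁ a) i = reassoc i.1.1.space i.1.2.space i.2.space
      (opTensor (i.1.1.hom a) 1) := rfl

lemma opTensor_left_mul_right {H K : Type u} [NormedAddCommGroup H] [InnerProductSpace ℂ H]
    [NormedAddCommGroup K] [InnerProductSpace ℂ K] (S : H →L[ℂ] H) (T : K →L[ℂ] K) :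
    opTensor S 1 * opTensor 1 T = opTensor S T := by
  rw [← opTensor_mul, one_mul, mul_one]

lemma opTensor_right_mul_left {H K : Type u} [NormedAddCommGroup H] [InnerProductSpace ℂ H]
    [NormedAddCommGroup K] [InnerProductSpace ℂ K] (S : H →L[ℂ] H) (T : K →L[ℂ] K) :
    opTensor 1 T * opTensor S 1 = opTensor S T := by
  rw [← opTensor_mul, one_mul, mul_one]

lemma opTensor_mul_legs {H K : Type u} [NormedAddCommGroup H] [InnerProductSpace ℂ H]
    [NormedAddCommGroup K] [InnerProductSpace ℂ K] {S S₁ S₂ : H →L[ℂ] H} {T T₁ T₂ : K →L[ℂ] K}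
    (hS : S * S₁ = S₂) (hT : T * T₁ = T₂) :
    opTensor S T * (opTensor S₁ 1 * opTensor 1 T₁) = opTensor S₂ 1 * opTensor 1 T₂ := by
  rw [opTensor_left_mul_right, opTensor_left_mul_right, ← opTensor_mul, hS, hT]

lemma reassoc_mul_legs {H K L : Type u} [NormedAddCommGroup H] [InnerProductSpace ℂ H]
    [NormedAddCommGroup K] [InnerProductSpace ℂ K]
    [NormedAddCommGroup L] [InnerProductSpace ℂ L]
    {S S₁ S₂ : H →L[ℂ] H} {T T₁ T₂ : HTensor K L →L[ℂ] HTensor K L}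
    (hS : S * S₁ = S₂) (hT : T * T₁ = T₂) :
    reassoc H K L (opTensor S T) *
        (reassoc H K L (opTensor 1 T₁) * reassoc H K L (opTensor S₁ 1)) =
      reassoc H K L (opTensor 1 T₂) * reassoc H K L (opTensor S₂ 1) := by
  have key : opTensor S T * (opTensor 1 T₁ * opTensor S₁ 1) = opTensor 1 T₂ * opTensor S₂ 1 := by
    rw [opTensor_right_mul_left S₁ T₁, opTensor_right_mul_left S₂ T₂, ← opTensor_mul, hS, hT]
  calc _ = reassoc H K L (opTensor S T * (opTensor 1 T₁ * opTensor S₁ 1)) := by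
        rw [reassoc_mul, reassoc_mul]
    _ = _ := by rw [key, reassoc_mul]

lemma reassoc_legs {H K L : Type u} [NormedAddCommGroup H] [InnerProductSpace ℂ H]
    [NormedAddCommGroup K] [InnerProductSpace ℂ K]
    [NormedAddCommGroup L] [InnerProductSpace ℂ L]
    (R : H →L[ℂ] H) (S : K →L[ℂ] K) (T : L →L[ℂ] L) :
    reassoc H K L (opTensor 1 (opTensor S T)) * reassoc H K L (opTensor R 1) =
      opTensor (opTensor R S) T := by
  rw [← reassoc_mul, opTensor_right_mul_left, reassoc_opTensor]

lemma extendHom_tensorRep_tmul (π ρ : HilbertRep A) (a b : A) :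
    extendHom (tensorRep π ρ) (tensorRep_nondeg π ρ) (tmul a b : 𝓜(ℂ, MinTensor A)) =
      opTensor (π.hom a) (ρ.hom b) :=
  extendHom_coe (θ := tensorRep π ρ) (tensorRep_nondeg π ρ) (tmul a b)

lemma leg₁₂_mul_leg₃ (a b c : A) : leg₁₂ (tmul a b) * leg₃ c = elem₃ a b c :=
  ops₃_ext fun i => opTensor_left_mul_right (opTensor (i.1.1.hom a) (i.1.2.hom b)) (i.2.hom c)

lemma leg₂₃_mul_leg₁ (a b c : A) : leg₂₃ (tmul b c) * leg₁ a = elem₃ a b c :=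
  ops₃_ext fun i => reassoc_legs (i.1.1.hom a) (i.1.2.hom b) (i.2.hom c)

/-- The operators `((π ⊗ ρ) φ ⊗ σ) x` for a multiplier `x` of `A ⊗ A`. -/
def tensorIdAux (hφ : IsNondegenerateHom φ) : 𝓜(ℂ, MinTensor A) →⋆ₙₐ[ℂ] Ops₃ A :=
  familyHom fun i : (HilbertRep A × HilbertRep A) × HilbertRep A =>
    extendHom (tensorRep (convRep hφ i.1.1 i.1.2) i.2) (tensorRep_nondeg _ _)

/-- The operators `(π ⊗ (ρ ⊗ σ) φ) x` for a multiplier `x` of `A ⊗ A`. -/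
def idTensorAux (hφ : IsNondegenerateHom φ) : 𝓜(ℂ, MinTensor A) →⋆ₙₐ[ℂ] Ops₃ A :=
  familyHom fun i : (HilbertRep A × HilbertRep A) × HilbertRep A =>
    (reassoc i.1.1.space i.1.2.space i.2.space).comp
      (extendHom (tensorRep i.1.1 (convRep hφ i.1.2 i.2)) (tensorRep_nondeg _ _))

lemma ev₃_tensorIdAux (hφ : IsNondegenerateHom φ) (x : 𝓜(ℂ, MinTensor A)) (i : (HilbertRep A × HilbertRep A) × HilbertRep A) :
    ev₃ (tensorIdAux hφ x) i =
      extendHom (tensorRep (convRep hφ i.1.1 i.1.2) i.2) (tensorRep_nondeg _ _) x := rfl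

lemma ev₃_idTensorAux (hφ : IsNondegenerateHom φ) (x : 𝓜(ℂ, MinTensor A)) (i : (HilbertRep A × HilbertRep A) × HilbertRep A) :
    ev₃ (idTensorAux hφ x) i = reassoc i.1.1.space i.1.2.space i.2.space
      (extendHom (tensorRep i.1.1 (convRep hφ i.1.2 i.2)) (tensorRep_nondeg _ _) x) := rfl

lemma tensorIdAux_tmul (hφ : IsNondegenerateHom φ) (a b : A) (w : MinTensor A) (c : A) :
    tensorIdAux hφ (tmul a b : 𝓜(ℂ, MinTensor A)) * (leg₁₂ w * leg₃ c) =
      leg₁₂ ((φ a).fst w) * leg₃ (b * c) :=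
  ops₃_ext fun i =>
    (congrArg (· * (opTensor (tensorRep i.1.1 i.1.2 w) 1 * opTensor 1 (i.2.hom c)))
      (extendHom_tensorRep_tmul (convRep hφ i.1.1 i.1.2) i.2 a b)).trans
    (opTensor_mul_legs (convRep_mul hφ i.1.1 i.1.2 a w) (i.2.hom_mul b c).symm)

lemma idTensorAux_tmul (hφ : IsNondegenerateHom φ) (a b : A) (w : MinTensor A) (c : A) :
    idTensorAux hφ (tmul a b : 𝓜(ℂ, MinTensor A)) * (leg₂₃ w * leg₁ c) =
      leg₂₃ ((φ b).fst w) * leg₁ (a * c) :=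
  ops₃_ext fun i =>
    (congrArg (fun z => reassoc i.1.1.space i.1.2.space i.2.space z *
        (reassoc i.1.1.space i.1.2.space i.2.space (opTensor 1 (tensorRep i.1.2 i.2 w)) *
          reassoc i.1.1.space i.1.2.space i.2.space (opTensor (i.1.1.hom c) 1)))
      (extendHom_tensorRep_tmul i.1.1 (convRep hφ i.1.2 i.2) a b)).trans
    (reassoc_mul_legs (i.1.1.hom_mul a c).symm (convRep_mul hφ i.1.2 i.2 b w))

lemma leg₁₂_mul_leg₃_mem (w : MinTensor A) (c : A) :
    leg₁₂ w * leg₃ c ∈ minTensorSubalgebra₃ A := by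
  refine map_mem_of_mem_closure_span
    (N := (minTensorSubalgebra₃ A).toNonUnitalSubalgebra.toSubmodule) (x := w)
    (((ContinuousLinearMap.mul ℂ (Ops₃ A)).flip (leg₃ c)).comp (homCLM leg₁₂))
    (inferInstance : IsClosed (minTensorSubalgebra₃ A : Set (Ops₃ A))) ?_
    (span_tmul_dense (A := A) ▸ Submodule.mem_top)
  rintro _ ⟨⟨a, b⟩, rfl⟩
  change leg₁₂ (tmul a b) * leg₃ c ∈ minTensorSubalgebra₃ A
  rw [leg₁₂_mul_leg₃]
  exact elem₃_mem _ _ _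

lemma leg₂₃_mul_leg₁_mem (w : MinTensor A) (a : A) :
    leg₂₃ w * leg₁ a ∈ minTensorSubalgebra₃ A := by
  refine map_mem_of_mem_closure_span
    (N := (minTensorSubalgebra₃ A).toNonUnitalSubalgebra.toSubmodule) (x := w)
    (((ContinuousLinearMap.mul ℂ (Ops₃ A)).flip (leg₁ a)).comp (homCLM leg₂₃))
    (inferInstance : IsClosed (minTensorSubalgebra₃ A : Set (Ops₃ A))) ?_
    (span_tmul_dense (A := A) ▸ Submodule.mem_top)
  rintro _ ⟨⟨b, c⟩, rfl⟩
  change leg₂₃ (tmul b c) * leg₁ a ∈ minTensorSubalgebra₃ A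
  rw [leg₂₃_mul_leg₁]
  exact elem₃_mem _ _ _

lemma span_tmul_dense_swap :
    (Submodule.span ℂ (Set.range fun p : A × A => tmul p.2 p.1)).topologicalClosure = ⊤ := by
  rw [← span_tmul_dense, ← (Equiv.prodComm A A).surjective.range_comp]
  rfl

/-- The star homomorphism `φ ⊗ ι` from the multiplier algebra of `A ⊗ A` to the multiplier
algebra of `A ⊗ A ⊗ A`: the extension of `a ⊗ b ↦ φ a ⊗ b` to multipliers. -/
def tensorId (hφ : IsNondegenerateHom φ) :
    𝓜(ℂ, MinTensor A) →⋆ₙₐ[ℂ] 𝓜(ℂ, MinTensor₃ A) :=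
  multiplierHom (minTensorSubalgebra₃ A) (tensorIdAux hφ) <|
    leg_mul_mem (minTensorSubalgebra₃ A) inferInstance hφ (tensorIdAux hφ) leg₁₂ leg₃ tmul
      span_tmul_dense leg₁₂_mul_leg₃_mem (fun t ht => by
        refine Submodule.topologicalClosure_mono ?_ (minTensorSubalgebra₃_le_span ht)
        refine Submodule.span_mono ?_
        rintro _ ⟨p, rfl⟩
        exact ⟨(tmul p.1.1 p.1.2, p.2), leg₁₂_mul_leg₃ _ _ _⟩)
      (tensorIdAux_tmul hφ)

/-- The star homomorphism `ι ⊗ φ` from the multiplier algebra of `A ⊗ A` to the multiplier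
algebra of `A ⊗ A ⊗ A`: the extension of `a ⊗ b ↦ a ⊗ φ b` to multipliers. -/
def idTensor (hφ : IsNondegenerateHom φ) :
    𝓜(ℂ, MinTensor A) →⋆ₙₐ[ℂ] 𝓜(ℂ, MinTensor₃ A) :=
  multiplierHom (minTensorSubalgebra₃ A) (idTensorAux hφ) <|
    leg_mul_mem (minTensorSubalgebra₃ A) inferInstance hφ (idTensorAux hφ) leg₂₃ leg₁
      (fun a b => tmul b a)
      span_tmul_dense_swap leg₂₃_mul_leg₁_mem (fun t ht => by
        refine Submodule.topologicalClosure_mono ?_ (minTensorSubalgebra₃_le_span ht)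
        refine Submodule.span_mono ?_
        rintro _ ⟨p, rfl⟩
        exact ⟨(tmul p.1.2 p.2, p.1.1), leg₂₃_mul_leg₁ _ _ _⟩)
      (fun a b => idTensorAux_tmul hφ b a)

end Slices

end MinTensorMaps

/-! ### Comultiplications -/

/-- A comultiplication on the C⋆-algebra `A` is a nondegenerate star homomorphism `φ` from `A` to
the multiplier algebra of the minimal tensor product `A ⊗ A` such that
`(φ ⊗ ι) φ = (ι ⊗ φ) φ`. -/
structure IsComultiplication {A : Type u} [NonUnitalCStarAlgebra A]
    (φ : A →⋆ₙₐ[ℂ] 𝓜(ℂ, MinTensor A)) : Prop where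
  nondegenerate : IsNondegenerateHom φ
  coassociative : ∀ a, tensorId nondegenerate (φ a) = idTensor nondegenerate (φ a)

end

end CStarTensor

/-!
The group is the character space `G` of `A`, and `Θ` is the Gelfand transform. Mathlib has Gelfand
duality for unital algebras; `gelfandStarEquiv` derives the non-unital case from it by embedding
the characters of an algebra as an open set into the characters of its unitization.

A character of an algebra `B` extends to the multipliers of `B` (`charExt`), so a nondegenerate
homomorphism from `A` to the multipliers of `B` pulls characters of `B` back to characters of `A`
continuously (`charPull`). Pulling back along `a ↦ a ⊗ 1` and `b ↦ 1 ⊗ b` identifies the characters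
of `A ⊗ A` with `G × G` (`prodCharHomeomorph`), the inverse map sending a pair `(p, q)` to the
character `p ⊗ q` by which `A ⊗ A` acts in the tensor product of the one-dimensional
representations `p` and `q`. This gives `Θ₂` (`minTensorEquiv`).

Pulling back along `φ` gives the product `p * q = (p ⊗ q) φ` on `G` (`charMul`), and the formula for
`φ` holds by construction. The product is associative because the two sides of the coassociativity
identity act on the line of `p ⊗ q ⊗ r` by the characters `(p * q) * r` and `p * (q * r)`
(`charMul_assoc`).

Under `Θ₂` the element `φ a * (1 ⊗ b)` is the function `a ⊗ b` composed with
`T (p, q) = (p * q, q)`. That it vanishes at infinity makes `T` proper, hence closed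
(`isClosedMap_of_tmul_comp`); that it vanishes only if `a ⊗ b` does gives `T` dense range
(`denseRange_of_tmul_comp`). So `T` is onto, and likewise `(p, q) ↦ (p * q, p)`: all equations
`x * q = r` and `p * x = r` are solvable in `G`, which is therefore a group. Its inversion is
continuous since `T` is a closed continuous bijection (`exists_isTopologicalGroup`).
-/

/-! ### Gelfand duality for non-unital commutative C⋆-algebras -/

namespace NonUnitalGelfand

open WeakDual Topology Filter

section Duality

variable {B : Type v} [NonUnitalCommCStarAlgebra B]

/-- The extension of a character of `B` to a character of the unitization of `B`. -/
noncomputable def extendUnitization (χ : characterSpace ℂ B) :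
    characterSpace ℂ (Unitization ℂ B) :=
  CharacterSpace.equivAlgHom.symm (Unitization.lift (CharacterSpace.toNonUnitalAlgHom χ))

@[simp] lemma extendUnitization_apply (χ : characterSpace ℂ B) (x : Unitization ℂ B) :
    extendUnitization χ x = x.fst + χ x.snd := rfl

lemma continuous_eval (b : B) : Continuous fun χ : characterSpace ℂ B => χ b :=
  (WeakDual.eval_continuous b).comp continuous_subtype_val

lemma continuous_of_continuous_eval {Y : Type*} [TopologicalSpace Y]
    {f : Y → characterSpace ℂ B} (hf : ∀ b, Continuous fun y => f y b) : Continuous f :=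
  (WeakDual.continuous_of_continuous_eval hf).subtype_mk _

/-- A nonzero bounded multiplicative functional, as a character. -/
noncomputable def mkChar (f : B →L[ℂ] ℂ) (hf : ∃ b, f b ≠ 0) (hmul : ∀ a b, f (a * b) = f a * f b) :
    characterSpace ℂ B :=
  ⟨StrongDual.toWeakDual f,
    fun h => hf.elim fun b hb => hb (DFunLike.congr_fun h b), hmul⟩

lemma exists_apply_ne_zero (χ : characterSpace ℂ B) : ∃ b, χ b ≠ 0 := by
  by_contra! h
  exact χ.2.1 (DFunLike.ext _ _ h)

@[simp] lemma mkChar_apply (f : B →L[ℂ] ℂ) (hf : ∃ b, f b ≠ 0)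
    (hmul : ∀ a b, f (a * b) = f a * f b) (b : B) : mkChar f hf hmul b = f b := rfl

/-- The inclusion of `B` into its unitization, as a bounded linear map. -/
noncomputable def inrCLM : B →L[ℂ] Unitization ℂ B :=
  LinearMap.mkContinuous (Unitization.inrNonUnitalStarAlgHom ℂ B : B →ₗ[ℂ] Unitization ℂ B) 1
    (fun b => by simp [Unitization.norm_inr])

/-- The only character of the unitization that is not an extension of a character of `B` is the one
vanishing on `B`. -/
lemma range_extendUnitization :
    Set.range (extendUnitization : characterSpace ℂ B → _) =
      {ψ | ∃ b : B, ψ (b : Unitization ℂ B) ≠ 0} := by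
  ext ψ
  constructor
  · rintro ⟨χ, rfl⟩
    obtain ⟨b, hb⟩ := exists_apply_ne_zero χ
    exact ⟨b, by simpa using hb⟩
  · intro h
    refine ⟨mkChar ((CharacterSpace.toCLM ψ).comp inrCLM) h fun a b => ?_, ?_⟩
    · change ψ ((a * b : B) : Unitization ℂ B) = ψ a * ψ b
      rw [Unitization.inr_mul, map_mul]
    · refine CharacterSpace.ext fun x => ?_
      induction x with
      | inl_add_inr r b =>
        rw [extendUnitization_apply, map_add, ← Unitization.algebraMap_eq_inl, AlgHomClass.commutes]
        simp [inrCLM, Unitization.algebraMap_eq_inl]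

lemma isOpenEmbedding_extendUnitization :
    IsOpenEmbedding (extendUnitization : characterSpace ℂ B → _) := by
  have hc : Continuous (extendUnitization : characterSpace ℂ B → _) := by
    refine continuous_of_continuous_eval fun x => ?_
    simp only [extendUnitization_apply]
    exact continuous_const.add (continuous_eval _)
  have hg : Continuous fun (ψ : characterSpace ℂ (Unitization ℂ B)) (b : B) =>
      ψ (b : Unitization ℂ B) := continuous_pi fun b => continuous_eval _
  -- The topology of the character space is the one induced by evaluation at elements of `B`.
  refine ⟨⟨IsInducing.of_comp hc hg ?_, ?_⟩, ?_⟩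
  · have h1 : IsInducing fun (χ : WeakDual ℂ B) (b : B) => χ b := ⟨rfl⟩
    convert h1.comp (IsInducing.subtypeVal (t := characterSpace ℂ B)) using 2
    ext b
    simp
  · intro χ₁ χ₂ h
    refine CharacterSpace.ext fun b => ?_
    simpa using DFunLike.congr_fun h (b : Unitization ℂ B)
  · rw [range_extendUnitization]
    simp only [Set.ofPred_exists]
    exact isOpen_iUnion fun b => isOpen_ne_fun (continuous_eval _) continuous_const

instance : LocallyCompactSpace (characterSpace ℂ B) :=
  isOpenEmbedding_extendUnitization.locallyCompactSpace

lemma map_star_char (χ : characterSpace ℂ B) (b : B) : χ (star b) = star (χ b) := by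
  have := map_star (extendUnitization χ) (b : Unitization ℂ B)
  rw [← Unitization.inr_star] at this
  simpa using this

lemma eq_zero_of_forall_char {b : B} (h : ∀ χ : characterSpace ℂ B, χ b = 0) : b = 0 := by
  -- A character of the unitization extends a character of `B` or vanishes on `B`.
  have h0 : gelfandTransform ℂ (Unitization ℂ B) (b : Unitization ℂ B) = 0 := by
    ext ψ
    by_cases hψ : ψ ∈ Set.range (extendUnitization : characterSpace ℂ B → _)
    · obtain ⟨χ, rfl⟩ := hψ
      change extendUnitization χ (b : Unitization ℂ B) = 0
      simpa using h χ
    · rw [range_extendUnitization] at hψ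
      simp only [Set.mem_ofPred_eq, not_exists, not_not] at hψ
      exact hψ b
  exact Unitization.inr_injective
    ((gelfandTransform_bijective (Unitization ℂ B)).1 (h0.trans (map_zero _).symm))

lemma isCompact_le_norm_eval (b : B) {ε : ℝ} (hε : 0 < ε) :
    IsCompact {χ : characterSpace ℂ B | ε ≤ ‖χ b‖} := by
  rw [isOpenEmbedding_extendUnitization.isInducing.isCompact_iff]
  have : extendUnitization '' {χ : characterSpace ℂ B | ε ≤ ‖χ b‖} =
      {ψ | ε ≤ ‖ψ (b : Unitization ℂ B)‖} := by
    ext ψ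
    constructor
    · rintro ⟨χ, hχ, rfl⟩
      simpa using hχ
    · intro hψ
      have : ψ ∈ Set.range (extendUnitization : characterSpace ℂ B → _) := by
        rw [range_extendUnitization]
        exact ⟨b, norm_pos_iff.mp (hε.trans_le hψ)⟩
      obtain ⟨χ, rfl⟩ := this
      exact ⟨χ, by simpa using hψ, rfl⟩
  rw [this]
  exact (isClosed_le continuous_const (continuous_eval _).norm).isCompact

/-- Evaluation of characters at `b`, as a function vanishing at infinity. -/
noncomputable def gelfandFun (b : B) : C₀(characterSpace ℂ B, ℂ) where
  toFun χ := χ b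
  continuous_toFun := continuous_eval b
  zero_at_infty' := by
    refine Metric.tendsto_nhds.mpr fun ε hε => ?_
    filter_upwards [(isCompact_le_norm_eval b hε).compl_mem_cocompact] with χ hχ
    simpa using hχ

/-- The extension by zero of a function vanishing at infinity along an open embedding into a
Hausdorff space is continuous. -/
lemma continuous_extend_zero {X Y : Type*} [TopologicalSpace X] [TopologicalSpace Y] [T2Space Y]
    {e : X → Y} (he : IsOpenEmbedding e) (f : C₀(X, ℂ)) :
    Continuous (Function.extend e f 0) := by
  rw [continuous_iff_continuousAt]
  intro y
  by_cases hy : y ∈ Set.range e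
  · obtain ⟨x, rfl⟩ := hy
    rw [← he.continuousAt_iff, Function.extend_comp he.injective]
    exact f.continuous.continuousAt
  · rw [ContinuousAt, Function.extend_apply' _ _ _ hy, Metric.tendsto_nhds]
    intro ε hε
    obtain ⟨K, hK, hKf⟩ := mem_cocompact.mp
      ((Metric.tendsto_nhds.mp f.zero_at_infty') ε hε)
    filter_upwards [(hK.image he.continuous).isClosed.isOpen_compl.mem_nhds
      (fun h => hy (Set.image_subset_range _ _ h))] with z hz
    by_cases hz' : z ∈ Set.range e
    · obtain ⟨x, rfl⟩ := hz'
      rw [he.injective.extend_apply]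
      exact hKf fun hx => hz ⟨x, hx, rfl⟩
    · rw [Function.extend_apply' _ _ _ hz']
      simpa using hε

lemma gelfandFun_bijective : Function.Bijective (gelfandFun : B → _) := by
  constructor
  · intro a b h
    rw [← sub_eq_zero]
    refine eq_zero_of_forall_char fun χ => ?_
    rw [map_sub, sub_eq_zero]
    exact DFunLike.congr_fun h χ
  · intro f
    obtain ⟨x, hx⟩ := (gelfandTransform_bijective (Unitization ℂ B)).2
      ⟨_, continuous_extend_zero isOpenEmbedding_extendUnitization f⟩
    have hval : ∀ ψ, ψ x = Function.extend extendUnitization f 0 ψ := DFunLike.congr_fun hx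
    -- The character of the unitization that vanishes on `B` reads off the scalar part of `x`.
    have hfst : x.fst = 0 := by
      have h := hval (CharacterSpace.equivAlgHom.symm (Unitization.fstHom ℂ B))
      rw [Function.extend_apply'] at h
      · exact h
      · rw [← Set.mem_range, range_extendUnitization]
        rintro ⟨b, hb⟩
        exact hb (Unitization.fst_inr ℂ b)
    refine ⟨x.snd, ZeroAtInftyContinuousMap.ext fun χ => ?_⟩
    have h := hval (extendUnitization χ)
    rw [isOpenEmbedding_extendUnitization.injective.extend_apply, extendUnitization_apply, hfst,
      zero_add] at h
    exact h

variable (B) in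
/-- The Gelfand representation of a commutative C⋆-algebra `B` as `C₀(X)`, where `X` is the space
of characters of `B`. -/
noncomputable def gelfandStarEquiv : B ≃⋆ₐ[ℂ] C₀(characterSpace ℂ B, ℂ) :=
  StarAlgEquiv.ofBijective
    ({ toFun := gelfandFun
       map_smul' := fun c b => ZeroAtInftyContinuousMap.ext fun χ => map_smul χ c b
       map_zero' := ZeroAtInftyContinuousMap.ext fun χ => map_zero χ
       map_add' := fun a b => ZeroAtInftyContinuousMap.ext fun χ => map_add χ a b
       map_mul' := fun a b => ZeroAtInftyContinuousMap.ext fun χ => map_mul χ a b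
       map_star' := fun b => ZeroAtInftyContinuousMap.ext fun χ => map_star_char χ b } :
      B →⋆ₙₐ[ℂ] C₀(characterSpace ℂ B, ℂ)) gelfandFun_bijective

@[simp] lemma gelfandStarEquiv_apply (b : B) (χ : characterSpace ℂ B) :
    gelfandStarEquiv B b χ = χ b := rfl

instance [Nontrivial B] : Nonempty (characterSpace ℂ B) := by
  by_contra h
  obtain ⟨b, hb⟩ := exists_ne (0 : B)
  exact hb (eq_zero_of_forall_char fun χ => (h ⟨χ⟩).elim)

/-- Urysohn's lemma in terms of elements of the algebra. -/
lemma exists_eq_one_eq_zero {K U : Set (characterSpace ℂ B)} (hK : IsCompact K) (hU : IsOpen U)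
    (hKU : K ⊆ U) : ∃ b : B, (∀ χ ∈ K, χ b = 1) ∧ ∀ χ ∉ U, χ b = 0 := by
  obtain ⟨f, hf1, hf0, hfc, -⟩ := exists_continuous_one_zero_of_isCompact hK hU.isClosed_compl
    (Set.disjoint_compl_right_iff_subset.mpr hKU)
  obtain ⟨b, hb⟩ := (gelfandStarEquiv B).surjective
    { toFun := fun χ => (f χ : ℂ)
      continuous_toFun := by fun_prop
      zero_at_infty' := (hfc.comp_left (g := ((↑) : ℝ → ℂ)) Complex.ofReal_zero).is_zero_at_infty }
  have hb' : ∀ χ, χ b = (f χ : ℂ) := DFunLike.congr_fun hb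
  refine ⟨b, fun χ hχ => ?_, fun χ hχ => ?_⟩
  · rw [hb', hf1 hχ]; simp
  · rw [hb', hf0 hχ]; simp

end Duality

/-- Precomposition with a homeomorphism, as an isomorphism of algebras of functions vanishing at
infinity. -/
noncomputable def compHomeomorph {X Y : Type*} [TopologicalSpace X] [TopologicalSpace Y]
    (h : X ≃ₜ Y) : C₀(Y, ℂ) ≃⋆ₐ[ℂ] C₀(X, ℂ) :=
  StarAlgEquiv.ofBijective
    ({ toFun := fun f => ⟨f.toContinuousMap.comp h, f.zero_at_infty'.comp
          h.isClosedEmbedding.tendsto_cocompact⟩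
       map_smul' := fun _ _ => rfl
       map_zero' := rfl
       map_add' := fun _ _ => rfl
       map_mul' := fun _ _ => rfl
       map_star' := fun _ => rfl } : C₀(Y, ℂ) →⋆ₙₐ[ℂ] C₀(X, ℂ))
    ⟨fun f g hfg => ZeroAtInftyContinuousMap.ext fun y => by
        have := DFunLike.congr_fun hfg (h.symm y)
        change f (h (h.symm y)) = g (h (h.symm y)) at this
        rwa [h.apply_symm_apply] at this,
      fun f => ⟨⟨f.toContinuousMap.comp h.symm, f.zero_at_infty'.comp
        h.symm.isClosedEmbedding.tendsto_cocompact⟩,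
        ZeroAtInftyContinuousMap.ext fun x => congrArg f (h.symm_apply_apply x)⟩⟩

end NonUnitalGelfand

/-! ### Topological semigroups with proper division -/

/-- A nonempty semigroup in which all equations `x * q = r` and `p * x = r` are solvable is a
group. -/
lemma exists_group_of_divisible {S : Type*} [Nonempty S] (m : S → S → S)
    (assoc : ∀ p q r, m (m p q) r = m p (m q r)) (hl : ∀ r q, ∃ x, m x q = r)
    (hr : ∀ r p, ∃ x, m p x = r) : ∃ _ : Group S, ∀ p q, p * q = m p q := by
  obtain ⟨s⟩ := ‹Nonempty S›
  -- A left identity for one element is a left identity, as every element is of the form `s * x`.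
  obtain ⟨e, he⟩ := hl s s
  have one_mul : ∀ a, m e a = a := fun a => by
    obtain ⟨x, rfl⟩ := hr a s
    rw [← assoc, he]
  choose i hi using hl e
  let _ : Mul S := ⟨m⟩
  let _ : One S := ⟨e⟩
  let _ : Inv S := ⟨i⟩
  exact ⟨Group.ofLeftAxioms assoc one_mul hi, fun _ _ => rfl⟩

/-- Let `m` be a continuous associative multiplication on a nonempty space. If the maps
`(p, q) ↦ (p q, q)` and `(p, q) ↦ (p q, p)` are closed with dense range, then `m` is the
multiplication of a topological group. -/
theorem exists_isTopologicalGroup {S : Type*} [TopologicalSpace S]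
    [Nonempty S] (m : S → S → S) (hm : Continuous fun x : S × S => m x.1 x.2)
    (assoc : ∀ p q r, m (m p q) r = m p (m q r))
    (hl : IsClosedMap fun x : S × S => (m x.1 x.2, x.2))
    (hl' : DenseRange fun x : S × S => (m x.1 x.2, x.2))
    (hr : IsClosedMap fun x : S × S => (m x.1 x.2, x.1))
    (hr' : DenseRange fun x : S × S => (m x.1 x.2, x.1)) :
    ∃ (_ : Group S) (_ : IsTopologicalGroup S), ∀ p q, p * q = m p q := by
  have surj : ∀ {f : S × S → S × S}, IsClosedMap f → DenseRange f → Function.Surjective f :=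
    fun hf hf' => Set.range_eq_univ.mp (by rw [← hf'.closure_range, hf.isClosed_range.closure_eq])
  obtain ⟨G, hG⟩ := exists_group_of_divisible m assoc
    (fun r q => by
      obtain ⟨x, hx⟩ := surj hl hl' (r, q)
      simp only [Prod.mk.injEq] at hx
      exact ⟨x.1, by rw [← hx.2, hx.1]⟩)
    (fun r p => by
      obtain ⟨x, hx⟩ := surj hr hr' (r, p)
      simp only [Prod.mk.injEq] at hx
      exact ⟨x.2, by rw [← hx.2, hx.1]⟩)
  -- Inversion is a component of the inverse of the homeomorphism `(p, q) ↦ (p q, q)`.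
  let T : S × S ≃ S × S :=
    { toFun := fun x => (m x.1 x.2, x.2)
      invFun := fun x => (x.1 * x.2⁻¹, x.2)
      left_inv := fun x => by simp [← hG]
      right_inv := fun x => by simp [← hG] }
  have hT : Continuous T.symm := (T.toHomeomorphOfContinuousClosed
    (hm.prodMk continuous_snd) hl).symm.continuous
  refine ⟨G, { continuous_mul := by simpa only [hG] using hm, continuous_inv := ?_ }, hG⟩
  have h : (fun p : S => p⁻¹) = fun p => (T.symm (1, p)).1 := by
    ext p
    simp [T]
  rw [h]
  exact continuous_fst.comp (hT.comp (by fun_prop))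

namespace CStarTensor

open WeakDual NonUnitalGelfand Topology Filter

/-! ### Characters and multipliers -/

section Multipliers

variable {B : Type v} [NonUnitalCommCStarAlgebra B]

/-- The action of multipliers on a fixed element `b`, as a bounded linear map. -/
noncomputable def multiplierApply (b : B) : 𝓜(ℂ, B) →L[ℂ] B :=
  LinearMap.mkContinuous
    { toFun := fun m => m.fst b
      map_add' := fun m n => by simp
      map_smul' := fun c m => by simp } ‖b‖
    (fun m => by
      rw [mul_comm, ← DoubleCentralizer.norm_fst]
      exact m.fst.le_opNorm b)

/-- The extension of a character of `B` to the multiplier algebra of `B`. It is computed on an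
element of `B` at which the character does not vanish. -/
noncomputable def charExt (χ : characterSpace ℂ B) : 𝓜(ℂ, B) →L[ℂ] ℂ :=
  (χ (exists_apply_ne_zero χ).choose)⁻¹ •
    (CharacterSpace.toCLM χ).comp (multiplierApply (exists_apply_ne_zero χ).choose)

/-- The defining property of the extension of a character to multipliers, which also shows that it
does not depend on the element chosen. -/
lemma char_fst (χ : characterSpace ℂ B) (m : 𝓜(ℂ, B)) (x : B) :
    χ (m.fst x) = charExt χ m * χ x := by
  set b := (exists_apply_ne_zero χ).choose with hb
  have hb0 : χ b ≠ 0 := (exists_apply_ne_zero χ).choose_spec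
  have h : χ (m.fst x) * χ b = χ (m.fst b) * χ x := by
    rw [← map_mul, ← map_mul, ← fst_mul, ← fst_mul, mul_comm]
  change _ = (χ b)⁻¹ * χ (m.fst b) * χ x
  rw [mul_assoc, ← h]
  field_simp

lemma charExt_eq {χ : characterSpace ℂ B} {m : 𝓜(ℂ, B)} {c : ℂ} {x : B} (hx : χ x ≠ 0)
    (h : χ (m.fst x) = c * χ x) : charExt χ m = c :=
  mul_right_cancel₀ hx ((char_fst χ m x).symm.trans h)

lemma charExt_mul (χ : characterSpace ℂ B) (m n : 𝓜(ℂ, B)) :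
    charExt χ (m * n) = charExt χ m * charExt χ n := by
  obtain ⟨x, hx⟩ := exists_apply_ne_zero χ
  refine charExt_eq hx ?_
  rw [mul_assoc, ← char_fst, ← char_fst]
  rfl

lemma charExt_coe (χ : characterSpace ℂ B) (b : B) : charExt χ (b : 𝓜(ℂ, B)) = χ b := by
  obtain ⟨x, hx⟩ := exists_apply_ne_zero χ
  refine charExt_eq hx ?_
  rw [← map_mul]
  rfl

variable {A : Type u} [NonUnitalCommCStarAlgebra A]

/-- A star homomorphism `φ` from `A` to the multiplier algebra of `B` is pointwise nonzero if no
character of `B` vanishes on all of the elements `φ a * x`. -/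
def IsPointwiseNonzero (φ : A →⋆ₙₐ[ℂ] 𝓜(ℂ, B)) : Prop :=
  ∀ χ : characterSpace ℂ B, ∃ a x, χ ((φ a).fst x) ≠ 0

lemma IsNondegenerateHom.isPointwiseNonzero {φ : A →⋆ₙₐ[ℂ] 𝓜(ℂ, B)}
    (hφ : IsNondegenerateHom φ) : IsPointwiseNonzero φ := by
  intro χ
  by_contra! h
  obtain ⟨x, hx⟩ := exists_apply_ne_zero χ
  refine hx (map_mem_of_mem_closure_span (N := (⊥ : Submodule ℂ ℂ)) (x := x)
    (CharacterSpace.toCLM χ) isClosed_singleton ?_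
    ((show _ = _ from hφ) ▸ Submodule.mem_top))
  rintro _ ⟨p, rfl⟩
  exact h _ _

/-- The character `a ↦ χ (φ a)` of `A`, where the character `χ` of `B` is extended to
multipliers. -/
noncomputable def charPull {φ : A →⋆ₙₐ[ℂ] 𝓜(ℂ, B)} (hφ : IsPointwiseNonzero φ)
    (χ : characterSpace ℂ B) : characterSpace ℂ A :=
  mkChar ((charExt χ).comp (homCLM φ))
    (by
      obtain ⟨a, x, h⟩ := hφ χ
      rw [char_fst] at h
      exact ⟨a, left_ne_zero_of_mul h⟩)
    (fun a b => by simp [charExt_mul])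

@[simp] lemma charPull_apply {φ : A →⋆ₙₐ[ℂ] 𝓜(ℂ, B)} (hφ : IsPointwiseNonzero φ)
    (χ : characterSpace ℂ B) (a : A) : charPull hφ χ a = charExt χ (φ a) := rfl

lemma continuous_charExt (m : 𝓜(ℂ, B)) :
    Continuous fun χ : characterSpace ℂ B => charExt χ m := by
  rw [continuous_iff_continuousAt]
  intro χ
  obtain ⟨x, hx⟩ := exists_apply_ne_zero χ
  have h : ContinuousAt (fun ψ : characterSpace ℂ B => ψ (m.fst x) / ψ x) χ :=
    (continuous_eval _).continuousAt.div (continuous_eval _).continuousAt hx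
  refine h.congr ?_
  filter_upwards [(continuous_eval x).continuousAt.eventually_ne hx] with ψ hψ
  rw [char_fst, mul_div_cancel_right₀ _ hψ]

lemma continuous_charPull {φ : A →⋆ₙₐ[ℂ] 𝓜(ℂ, B)} (hφ : IsPointwiseNonzero φ) :
    Continuous (charPull hφ) :=
  continuous_of_continuous_eval fun a => continuous_charExt (φ a)

end Multipliers

/-! ### Characters of the minimal tensor product -/

section TensorCharacters

variable {A : Type u} [NonUnitalCommCStarAlgebra A]

lemma minTensor_mul_comm (x y : MinTensor A) : x * y = y * x := by
  have hd : ∀ z : MinTensor A, z ∈ (Submodule.span ℂ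
      (Set.range fun p : A × A => tmul p.1 p.2)).topologicalClosure :=
    fun z => span_tmul_dense (A := A) ▸ Submodule.mem_top
  rw [← sub_eq_zero]
  refine map_mem_of_mem_closure_span (N := (⊥ : Submodule ℂ (MinTensor A))) (x := x)
    ((ContinuousLinearMap.mul ℂ (MinTensor A)).flip y - ContinuousLinearMap.mul ℂ (MinTensor A) y)
    isClosed_singleton ?_ (hd x)
  rintro _ ⟨⟨a, b⟩, rfl⟩
  refine map_mem_of_mem_closure_span (N := (⊥ : Submodule ℂ (MinTensor A))) (x := y)
    (ContinuousLinearMap.mul ℂ (MinTensor A) (tmul a b) -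
      (ContinuousLinearMap.mul ℂ (MinTensor A)).flip (tmul a b))
    isClosed_singleton ?_ (hd y)
  rintro _ ⟨⟨c, d⟩, rfl⟩
  refine sub_eq_zero.mpr (Subtype.ext ?_)
  change elem₂ a b * elem₂ c d = elem₂ c d * elem₂ a b
  rw [elem₂_mul, elem₂_mul, mul_comm a, mul_comm b]

noncomputable scoped instance : NonUnitalCommCStarAlgebra (MinTensor A) :=
  { (inferInstance : NonUnitalCStarAlgebra (MinTensor A)) with
    mul_comm := minTensor_mul_comm }

lemma tmul_mul_tmul (a b c d : A) : tmul a b * tmul c d = tmul (a * c) (b * d) :=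
  Subtype.ext (elem₂_mul a b c d)

lemma continuousLinearMap_ext_tmul {E : Type*} [NormedAddCommGroup E] [NormedSpace ℂ E]
    {f g : MinTensor A →L[ℂ] E} (h : ∀ a b, f (tmul a b) = g (tmul a b)) : f = g := by
  refine ContinuousLinearMap.ext_on (s := Set.range fun p : A × A => tmul p.1 p.2) ?_ ?_
  · rw [Submodule.dense_iff_topologicalClosure_eq_top]
    exact span_tmul_dense
  · rintro _ ⟨p, rfl⟩
    exact h _ _

lemma char_ext_tmul {χ ψ : characterSpace ℂ (MinTensor A)}
    (h : ∀ a b, χ (tmul a b) = ψ (tmul a b)) : χ = ψ :=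
  CharacterSpace.ext fun x => DFunLike.congr_fun
    (continuousLinearMap_ext_tmul (f := CharacterSpace.toCLM χ) (g := CharacterSpace.toCLM ψ) h) x

lemma exists_char_tmul_ne_zero (χ : characterSpace ℂ (MinTensor A)) :
    ∃ a b, χ (tmul a b) ≠ 0 := by
  by_contra! h
  obtain ⟨x, hx⟩ := exists_apply_ne_zero χ
  exact hx (DFunLike.congr_fun
    (continuousLinearMap_ext_tmul (f := CharacterSpace.toCLM χ) (g := 0) h) x)

/-- The one-dimensional representation given by a character. -/
noncomputable def charRep (p : characterSpace ℂ A) : HilbertRep A where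
  space := EuclideanSpace ℂ PUnit.{u + 1}
  hom :=
    { toFun := fun a => p a • 1
      map_smul' := fun c a => by simp [mul_smul]
      map_zero' := by simp
      map_add' := fun a b => by simp [add_smul]
      map_mul' := fun a b => by simp [mul_smul, smul_comm (p a)]
      map_star' := fun a => by rw [map_star_char, star_smul, star_one] }
  nondeg := by
    obtain ⟨a, ha⟩ := exists_apply_ne_zero p
    refine top_le_iff.mp (le_trans (fun v _ => ?_) (Submodule.le_topologicalClosure _))
    exact Submodule.subset_span ⟨(a, (p a)⁻¹ • v), by simp [smul_smul, ha]⟩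

/-- The unit vector spanning the space of `charRep p`. -/
noncomputable def charVec (p : characterSpace ℂ A) : (charRep p).space :=
  EuclideanSpace.single PUnit.unit 1

lemma norm_charVec (p : characterSpace ℂ A) : ‖charVec p‖ = 1 := by
  simp only [charVec]
  exact (PiLp.norm_single _ _ _ _).trans norm_one

/-- The vector `h` is a joint eigenvector of the representation `θ` with eigenvalues `χ b`. -/
def IsEigenvec {B : Type v} [NonUnitalCStarAlgebra B] {H : Type w} [NormedAddCommGroup H]
    [InnerProductSpace ℂ H] [CompleteSpace H] (θ : B →⋆ₙₐ[ℂ] (H →L[ℂ] H))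
    (χ : characterSpace ℂ B) (h : H) : Prop :=
  ∀ b, θ b h = χ b • h

lemma isEigenvec_charVec (p : characterSpace ℂ A) :
    IsEigenvec (charRep p).hom p (charVec p) := fun _ => rfl

/-- The character is the vector state of the unit vector in the tensor product of the
one-dimensional representations `p` and `q`, which is a joint eigenvector of `A ⊗ A`. -/
lemma exists_char_tmul (p q : characterSpace ℂ A) :
    ∃ χ : characterSpace ℂ (MinTensor A), ∀ a b, χ (tmul a b) = p a * q b := by
  set ξ := htmul (charVec p) (charVec q) with hξ
  have hξ1 : ‖ξ‖ = 1 := by rw [hξ, htmul_norm, norm_charVec, norm_charVec, one_mul]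
  set f : MinTensor A →L[ℂ] ℂ :=
    (innerSL ℂ ξ).comp (repVec (tensorRep (charRep p) (charRep q)) ξ) with hf
  have hξξ : inner ℂ ξ ξ = (1 : ℂ) := by simp [inner_self_eq_norm_sq_to_K, hξ1]
  have htm : ∀ a b, tensorRep (charRep p) (charRep q) (tmul a b) ξ = (p a * q b) • ξ := by
    intro a b
    rw [tensorRep_tmul, hξ, opTensor_htmul, isEigenvec_charVec p a, isEigenvec_charVec q b,
      htmul_smul_left, htmul_smul_right, smul_smul]
  have hft : ∀ a b, f (tmul a b) = p a * q b := by
    intro a b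
    change inner ℂ ξ (tensorRep (charRep p) (charRep q) (tmul a b) ξ) = _
    rw [htm, inner_smul_right, hξξ, mul_one]
  have heig : ∀ x, tensorRep (charRep p) (charRep q) x ξ = f x • ξ := fun x =>
    DFunLike.congr_fun (continuousLinearMap_ext_tmul
      (f := repVec (tensorRep (charRep p) (charRep q)) ξ) (g := f.smulRight ξ)
      fun a b => by
        change tensorRep (charRep p) (charRep q) (tmul a b) ξ = f (tmul a b) • ξ
        rw [htm, hft]) x
  refine ⟨mkChar f ?_ ?_, hft⟩
  · obtain ⟨a, ha⟩ := exists_apply_ne_zero p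
    obtain ⟨b, hb⟩ := exists_apply_ne_zero q
    exact ⟨tmul a b, by rw [hft]; exact mul_ne_zero ha hb⟩
  · intro x y
    change inner ℂ ξ (tensorRep (charRep p) (charRep q) (x * y) ξ) = _
    rw [map_mul, mul_apply_eq_comp, heig y, map_smul, heig x, smul_smul,
      inner_smul_right, hξξ, mul_one, mul_comm]

/-- The character `p ⊗ q` of `A ⊗ A`. -/
noncomputable def prodChar (p q : characterSpace ℂ A) : characterSpace ℂ (MinTensor A) :=
  (exists_char_tmul p q).choose

@[simp] lemma prodChar_tmul (p q : characterSpace ℂ A) (a b : A) :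
    prodChar p q (tmul a b) = p a * q b :=
  (exists_char_tmul p q).choose_spec a b

lemma isPointwiseNonzero_tmulOne : IsPointwiseNonzero (tmulOne (A := A)) := by
  intro χ
  obtain ⟨a, b, h⟩ := exists_char_tmul_ne_zero χ
  refine ⟨a, tmul a (b * b), ?_⟩
  rw [tmulOne_tmul, ← tmul_mul_tmul, map_mul]
  exact mul_ne_zero h h

lemma isPointwiseNonzero_oneTmul : IsPointwiseNonzero (oneTmul (A := A)) := by
  intro χ
  obtain ⟨a, b, h⟩ := exists_char_tmul_ne_zero χ
  refine ⟨b, tmul (a * a) b, ?_⟩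
  rw [oneTmul_tmul, ← tmul_mul_tmul, map_mul]
  exact mul_ne_zero h h

lemma charExt_tmulOne_mul_oneTmul (χ : characterSpace ℂ (MinTensor A)) (a b : A) :
    charExt χ (tmulOne a) * charExt χ (oneTmul b) = χ (tmul a b) := by
  obtain ⟨c, d, h⟩ := exists_char_tmul_ne_zero χ
  refine mul_right_cancel₀ h ?_
  rw [mul_assoc, ← char_fst, oneTmul_tmul, ← char_fst, tmulOne_tmul, ← map_mul, tmul_mul_tmul]

lemma charExt_prodChar_tmulOne (p q : characterSpace ℂ A) (a : A) :
    charExt (prodChar p q) (tmulOne a) = p a := by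
  obtain ⟨c, d, h⟩ := exists_char_tmul_ne_zero (prodChar p q)
  refine charExt_eq h ?_
  rw [tmulOne_tmul, prodChar_tmul, prodChar_tmul, map_mul, mul_assoc]

lemma charExt_prodChar_oneTmul (p q : characterSpace ℂ A) (b : A) :
    charExt (prodChar p q) (oneTmul b) = q b := by
  obtain ⟨c, d, h⟩ := exists_char_tmul_ne_zero (prodChar p q)
  refine charExt_eq h ?_
  rw [oneTmul_tmul, prodChar_tmul, prodChar_tmul, map_mul, mul_left_comm]

lemma norm_char_apply_le {B : Type v} [NonUnitalCommCStarAlgebra B] (χ : characterSpace ℂ B)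
    (b : B) : ‖χ b‖ ≤ ‖b‖ :=
  NonUnitalStarAlgHom.norm_apply_le
    ({ CharacterSpace.toNonUnitalAlgHom χ with map_star' := map_star_char χ } : B →⋆ₙₐ[ℂ] ℂ) b

/-- The function is `(p, q) ↦ p a * q b` for an elementary tensor `x = a ⊗ b`, and for general `x` a
uniform limit of linear combinations of such products, since characters are contractive. -/
lemma continuous_prodChar_apply (x : MinTensor A) :
    Continuous fun y : characterSpace ℂ A × characterSpace ℂ A => prodChar y.1 y.2 x := by
  have hx : x ∈ closure ((Submodule.span ℂ (Set.range fun p : A × A => tmul p.1 p.2) :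
      Submodule ℂ (MinTensor A)) : Set (MinTensor A)) := by
    have := span_tmul_dense (A := A)
    exact (this ▸ Submodule.mem_top : x ∈ (Submodule.span ℂ
      (Set.range fun p : A × A => tmul p.1 p.2)).topologicalClosure)
  obtain ⟨s, hs, hsx⟩ := mem_closure_iff_seq_limit.mp hx
  have hcont : ∀ z ∈ Submodule.span ℂ (Set.range fun p : A × A => tmul p.1 p.2),
      Continuous fun y : characterSpace ℂ A × characterSpace ℂ A => prodChar y.1 y.2 z := by
    intro z hz
    induction hz using Submodule.span_induction with
    | mem z hz =>
      obtain ⟨p, rfl⟩ := hz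
      simp only [prodChar_tmul]
      exact ((continuous_eval p.1).comp continuous_fst).mul
        ((continuous_eval p.2).comp continuous_snd)
    | zero => simpa using continuous_const
    | add z w _ _ hz hw =>
      simp only [map_add]
      exact hz.add hw
    | smul c z _ hz => simpa using hz.const_mul c
  refine TendstoUniformly.continuous (F := fun n (y : characterSpace ℂ A × characterSpace ℂ A) =>
    prodChar y.1 y.2 (s n)) (p := atTop) ?_ (Frequently.of_forall fun n => hcont _ (hs n))
  rw [Metric.tendstoUniformly_iff]
  intro ε hε
  filter_upwards [(Metric.tendsto_nhds.mp hsx) ε hε] with n hn y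
  rw [dist_eq_norm, ← map_sub]
  refine (norm_char_apply_le _ _).trans_lt ?_
  rwa [← dist_eq_norm, dist_comm]

variable (A) in
/-- The characters of `A ⊗ A` are the products of two characters of `A`. -/
noncomputable def prodCharHomeomorph :
    characterSpace ℂ A × characterSpace ℂ A ≃ₜ characterSpace ℂ (MinTensor A) where
  toFun y := prodChar y.1 y.2
  invFun χ := (charPull isPointwiseNonzero_tmulOne χ, charPull isPointwiseNonzero_oneTmul χ)
  left_inv y := Prod.ext (CharacterSpace.ext fun a => charExt_prodChar_tmulOne _ _ a)
    (CharacterSpace.ext fun b => charExt_prodChar_oneTmul _ _ b)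
  right_inv χ := char_ext_tmul fun a b => by
    simp [charExt_tmulOne_mul_oneTmul]
  continuous_toFun := continuous_of_continuous_eval continuous_prodChar_apply
  continuous_invFun := (continuous_charPull _).prodMk (continuous_charPull _)

@[simp] lemma prodCharHomeomorph_apply (y : characterSpace ℂ A × characterSpace ℂ A) :
    prodCharHomeomorph A y = prodChar y.1 y.2 := rfl

/-- The identification of `A ⊗ A` with the functions vanishing at infinity on the square of the
character space of `A`. -/
noncomputable def minTensorEquiv :
    MinTensor A ≃⋆ₐ[ℂ] C₀(characterSpace ℂ A × characterSpace ℂ A, ℂ) :=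
  (gelfandStarEquiv (MinTensor A)).trans (compHomeomorph (prodCharHomeomorph A))

@[simp] lemma minTensorEquiv_apply (x : MinTensor A)
    (y : characterSpace ℂ A × characterSpace ℂ A) :
    minTensorEquiv x y = prodChar y.1 y.2 x := rfl

end TensorCharacters

/-! ### The product of characters -/

section Eigenvectors

/-- A joint eigenvector for a character is a joint eigenvector for its extension to multipliers. -/
lemma IsEigenvec.extendHom_apply {B : Type v} [NonUnitalCommCStarAlgebra B] {H : Type w}
    [NormedAddCommGroup H] [InnerProductSpace ℂ H] [CompleteSpace H]
    {θ : B →⋆ₙₐ[ℂ] (H →L[ℂ] H)} (hθ : IsNondegenerateRep θ) {χ : characterSpace ℂ B} {h : H}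
    (hh : IsEigenvec θ χ h) (m : 𝓜(ℂ, B)) : extendHom θ hθ m h = charExt χ m • h := by
  obtain ⟨x, hx⟩ := exists_apply_ne_zero χ
  have key : χ x • extendHom θ hθ m h = χ x • charExt χ m • h := by
    rw [← map_smul, ← hh x, CStarTensor.extendHom_apply, hh, char_fst, smul_smul, mul_comm]
  exact (smul_right_injective H hx) key

variable {A : Type u} [NonUnitalCommCStarAlgebra A]

lemma IsEigenvec.htmul {π ρ : HilbertRep A} {p q : characterSpace ℂ A} {h : π.space}
    {k : ρ.space} (hh : IsEigenvec π.hom p h) (hk : IsEigenvec ρ.hom q k) :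
    IsEigenvec (tensorRep π ρ) (prodChar p q) (htmul h k) := fun x =>
  DFunLike.congr_fun (continuousLinearMap_ext_tmul
    (f := repVec (tensorRep π ρ) (CStarTensor.htmul h k))
    (g := (CharacterSpace.toCLM (prodChar p q)).smulRight (CStarTensor.htmul h k))
    fun a b => by
      change tensorRep π ρ (tmul a b) (CStarTensor.htmul h k) =
        prodChar p q (tmul a b) • CStarTensor.htmul h k
      rw [tensorRep_tmul, opTensor_htmul, hh a, hk b, htmul_smul_left, htmul_smul_right,
        smul_smul, prodChar_tmul]) x

lemma extendHom_tensorRep_htmul {π ρ : HilbertRep A} {p q : characterSpace ℂ A} {h : π.space}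
    {k : ρ.space} (hh : IsEigenvec π.hom p h) (hk : IsEigenvec ρ.hom q k)
    (m : 𝓜(ℂ, MinTensor A)) :
    extendHom (tensorRep π ρ) (tensorRep_nondeg π ρ) m (CStarTensor.htmul h k) =
      charExt (prodChar p q) m • CStarTensor.htmul h k :=
  (hh.htmul hk).extendHom_apply (tensorRep_nondeg π ρ) m

variable {φ : A →⋆ₙₐ[ℂ] 𝓜(ℂ, MinTensor A)}

/-- The product `p * q = (p ⊗ q) φ` of two characters, where `φ` is a nondegenerate
homomorphism. -/
noncomputable def charMul (hφ : IsNondegenerateHom φ) (p q : characterSpace ℂ A) :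
    characterSpace ℂ A :=
  charPull hφ.isPointwiseNonzero (prodChar p q)

lemma charMul_apply (hφ : IsNondegenerateHom φ) (p q : characterSpace ℂ A) (a : A) :
    charMul hφ p q a = charExt (prodChar p q) (φ a) := rfl

lemma continuous_charMul (hφ : IsNondegenerateHom φ) :
    Continuous fun y : characterSpace ℂ A × characterSpace ℂ A => charMul hφ y.1 y.2 :=
  (continuous_charPull _).comp (prodCharHomeomorph A).continuous

lemma IsEigenvec.convRep (hφ : IsNondegenerateHom φ) {π ρ : HilbertRep A}
    {p q : characterSpace ℂ A} {h : π.space} {k : ρ.space} (hh : IsEigenvec π.hom p h)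
    (hk : IsEigenvec ρ.hom q k) :
    IsEigenvec (convRep hφ π ρ).hom (charMul hφ p q) (CStarTensor.htmul h k) := fun a =>
  extendHom_tensorRep_htmul hh hk (φ a)

lemma eq_of_mul_eq_of_eigen {H : Type*} [NormedAddCommGroup H] [NormedSpace ℂ H]
    {S T E : H →L[ℂ] H} {ξ : H} {s t e : ℂ} (h : S * E = T * E) (hξ : ξ ≠ 0) (he : e ≠ 0)
    (hE : E ξ = e • ξ) (hS : S ξ = s • ξ) (hT : T ξ = t • ξ) : s = t := by
  have hev := DFunLike.congr_fun h ξ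
  rw [mul_apply_eq_comp, mul_apply_eq_comp, hE, map_smul, map_smul, hS, hT] at hev
  exact smul_left_injective ℂ hξ (smul_right_injective H he hev)

lemma reassoc_htmul_of_eigen {H K L : Type u} [NormedAddCommGroup H] [InnerProductSpace ℂ H]
    [NormedAddCommGroup K] [InnerProductSpace ℂ K] [NormedAddCommGroup L] [InnerProductSpace ℂ L]
    {T : HTensor H (HTensor K L) →L[ℂ] HTensor H (HTensor K L)} {x : H} {y : K} {z : L} {c : ℂ}
    (h : T (CStarTensor.htmul x (CStarTensor.htmul y z)) =
      c • CStarTensor.htmul x (CStarTensor.htmul y z)) :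
    reassoc H K L T (CStarTensor.htmul (CStarTensor.htmul x y) z) =
      c • CStarTensor.htmul (CStarTensor.htmul x y) z := by
  rw [reassoc, conjHom_apply, LinearIsometryEquiv.symm_symm, htensorAssoc_htmul, h, map_smul,
    htensorAssoc_symm_htmul]

section Triple

variable {π ρ σ : HilbertRep A} {p q r : characterSpace ℂ A} {h : π.space} {k : ρ.space}
  {l : σ.space}

lemma ev₃_elem₃_of_eigenvec (hh : IsEigenvec π.hom p h) (hk : IsEigenvec ρ.hom q k)
    (hl : IsEigenvec σ.hom r l) (b c d : A) :
    ev₃ (elem₃ b c d) ((π, ρ), σ) (CStarTensor.htmul (CStarTensor.htmul h k) l) =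
      (p b * q c * r d) • CStarTensor.htmul (CStarTensor.htmul h k) l := by
  change opTensor (opTensor (π.hom b) (ρ.hom c)) (σ.hom d) _ = _
  rw [opTensor_htmul, opTensor_htmul, hh b, hk c, hl d, htmul_smul_left, htmul_smul_left,
    htmul_smul_right, htmul_smul_right, htmul_smul_left, smul_smul, smul_smul, mul_right_comm]

lemma ev₃_tensorIdAux_of_eigenvec (hφ : IsNondegenerateHom φ) (hh : IsEigenvec π.hom p h)
    (hk : IsEigenvec ρ.hom q k) (hl : IsEigenvec σ.hom r l) (a : A) :
    ev₃ (tensorIdAux hφ (φ a)) ((π, ρ), σ) (CStarTensor.htmul (CStarTensor.htmul h k) l) =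
      charMul hφ (charMul hφ p q) r a • CStarTensor.htmul (CStarTensor.htmul h k) l :=
  extendHom_tensorRep_htmul (hh.convRep hφ hk) hl (φ a)

lemma ev₃_idTensorAux_of_eigenvec (hφ : IsNondegenerateHom φ) (hh : IsEigenvec π.hom p h)
    (hk : IsEigenvec ρ.hom q k) (hl : IsEigenvec σ.hom r l) (a : A) :
    ev₃ (idTensorAux hφ (φ a)) ((π, ρ), σ) (CStarTensor.htmul (CStarTensor.htmul h k) l) =
      charMul hφ p (charMul hφ q r) a • CStarTensor.htmul (CStarTensor.htmul h k) l :=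
  reassoc_htmul_of_eigen (extendHom_tensorRep_htmul hh (hk.convRep hφ hl) (φ a))

/-- Evaluating both sides of the coassociativity identity on a joint eigenvector `h ⊗ k ⊗ l` with
eigenvalues `p`, `q`, `r` gives the two ways of bracketing `p * q * r`. -/
lemma charMul_assoc_of_eigenvec (hφ : IsComultiplication φ) (hh : IsEigenvec π.hom p h)
    (hk : IsEigenvec ρ.hom q k) (hl : IsEigenvec σ.hom r l)
    (hξ : CStarTensor.htmul (CStarTensor.htmul h k) l ≠ 0) :
    charMul hφ.nondegenerate (charMul hφ.nondegenerate p q) r =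
      charMul hφ.nondegenerate p (charMul hφ.nondegenerate q r) := by
  refine CharacterSpace.ext fun a => ?_
  obtain ⟨b, hb⟩ := exists_apply_ne_zero p
  obtain ⟨c, hc⟩ := exists_apply_ne_zero q
  obtain ⟨d, hd⟩ := exists_apply_ne_zero r
  have hco : tensorIdAux hφ.nondegenerate (φ a) * elem₃ b c d =
      idTensorAux hφ.nondegenerate (φ a) * elem₃ b c d :=
    congrArg (fun m : 𝓜(ℂ, MinTensor₃ A) => ((m.fst (tmul₃ b c d) : MinTensor₃ A) : Ops₃ A))
      (hφ.coassociative a)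
  exact eq_of_mul_eq_of_eigen (congrArg (fun x => ev₃ x ((π, ρ), σ)) hco) hξ
    (mul_ne_zero (mul_ne_zero hb hc) hd) (ev₃_elem₃_of_eigenvec hh hk hl b c d)
    (ev₃_tensorIdAux_of_eigenvec hφ.nondegenerate hh hk hl a)
    (ev₃_idTensorAux_of_eigenvec hφ.nondegenerate hh hk hl a)

end Triple

lemma charMul_assoc (hφ : IsComultiplication φ) (p q r : characterSpace ℂ A) :
    charMul hφ.nondegenerate (charMul hφ.nondegenerate p q) r =
      charMul hφ.nondegenerate p (charMul hφ.nondegenerate q r) := by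
  refine charMul_assoc_of_eigenvec hφ (isEigenvec_charVec p) (isEigenvec_charVec q)
    (isEigenvec_charVec r) ?_
  rw [← norm_ne_zero_iff, htmul_norm, htmul_norm, norm_charVec, norm_charVec, norm_charVec]
  simp

end Eigenvectors

/-! ### Proper and dense translations -/

section Translations

variable {A : Type u} [NonUnitalCommCStarAlgebra A]

/-- A continuous self-map `T` of the square of the character space is closed if all of the
functions `f ⊗ g` composed with `T` vanish at infinity. -/
lemma isClosedMap_of_tmul_comp {T : characterSpace ℂ A × characterSpace ℂ A →
      characterSpace ℂ A × characterSpace ℂ A} (hT : Continuous T)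
    (h : ∀ a b : A, ∃ x : MinTensor A, ∀ y, (T y).1 a * (T y).2 b = prodChar y.1 y.2 x) :
    IsClosedMap T := by
  refine (isProperMap_iff_isCompact_preimage.mpr ⟨hT, fun {K} hK => ?_⟩).isClosedMap
  -- If `a` and `b` are `1` on the projections of `K` then `a ⊗ b` is `1` on `K`.
  obtain ⟨a, ha, -⟩ := exists_eq_one_eq_zero (hK.image continuous_fst) isOpen_univ
    (Set.subset_univ _)
  obtain ⟨b, hb, -⟩ := exists_eq_one_eq_zero (hK.image continuous_snd) isOpen_univ
    (Set.subset_univ _)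
  obtain ⟨x, hx⟩ := h a b
  refine ((prodCharHomeomorph A).isCompact_preimage.mpr
    (isCompact_le_norm_eval x one_pos)).of_isClosed_subset (hK.isClosed.preimage hT) ?_
  intro y hy
  change 1 ≤ ‖prodChar y.1 y.2 x‖
  rw [← hx, ha _ ⟨_, hy, rfl⟩, hb _ ⟨_, hy, rfl⟩]
  simp

/-- A self-map `T` of the square of the character space has dense range if `f ⊗ g` composed with
`T` vanishes only if `f ⊗ g` does. -/
lemma denseRange_of_tmul_comp {T : characterSpace ℂ A × characterSpace ℂ A →
      characterSpace ℂ A × characterSpace ℂ A}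
    (h : ∀ a b : A, (∀ y, (T y).1 a * (T y).2 b = 0) → tmul a b = 0) : DenseRange T := by
  rw [DenseRange, dense_iff_inter_open]
  rintro W hW ⟨⟨p, q⟩, hpq⟩
  obtain ⟨U, V, hU, hV, hpU, hqV, hUV⟩ := isOpen_prod_iff.mp hW p q hpq
  obtain ⟨a, ha, ha'⟩ := exists_eq_one_eq_zero isCompact_singleton hU
    (Set.singleton_subset_iff.mpr hpU)
  obtain ⟨b, hb, hb'⟩ := exists_eq_one_eq_zero isCompact_singleton hV
    (Set.singleton_subset_iff.mpr hqV)
  by_contra hne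
  have h0 : tmul a b = 0 := h a b fun y => by
    by_contra hy
    refine hne ⟨T y, hUV ⟨?_, ?_⟩, y, rfl⟩
    · by_contra h1
      exact hy (by rw [ha' _ h1, zero_mul])
    · by_contra h1
      exact hy (by rw [hb' _ h1, mul_zero])
  have h1 := prodChar_tmul p q a b
  rw [h0, map_zero, ha p rfl, hb q rfl] at h1
  simp at h1

/-- A multiplier lying in the algebra vanishes if the extensions of all characters vanish at it. -/
lemma eq_zero_of_forall_charExt {m : 𝓜(ℂ, MinTensor A)} {x : MinTensor A}
    (hx : m = (x : 𝓜(ℂ, MinTensor A))) (h : ∀ p q, charExt (prodChar p q) m = 0) : m = 0 := by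
  have hx0 : x = 0 := eq_zero_of_forall_char fun χ => by
    have := h ((prodCharHomeomorph A).symm χ).1 ((prodCharHomeomorph A).symm χ).2
    rwa [← prodCharHomeomorph_apply, Homeomorph.apply_symm_apply, hx, charExt_coe] at this
  rw [hx, hx0]
  exact map_zero (DoubleCentralizer.coeHom (𝕜 := ℂ) (A := MinTensor A))

end Translations

/-! ### The group of characters -/

section GroupOfCharacters

variable {A : Type u} [NonUnitalCommCStarAlgebra A] {φ : A →⋆ₙₐ[ℂ] 𝓜(ℂ, MinTensor A)}

/-- As functions of two characters, `φ a * (1 ⊗ b)` and `φ a * (b ⊗ 1)` are `a ⊗ b` composed with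
`(p, q) ↦ (p * q, q)` and `(p, q) ↦ (p * q, p)`; the hypotheses make these maps closed with dense
range. -/
theorem exists_group_charMul [Nontrivial A] (hφ : IsComultiplication φ)
    (h₁ : ∀ a b : A, ∃ x : MinTensor A, φ a * oneTmul b = (x : 𝓜(ℂ, MinTensor A)))
    (h₂ : ∀ a b : A, ∃ x : MinTensor A, φ a * tmulOne b = (x : 𝓜(ℂ, MinTensor A)))
    (inj₁ : ∀ a b : A, φ a * oneTmul b = 0 → tmul a b = 0)
    (inj₂ : ∀ a b : A, φ a * tmulOne b = 0 → tmul a b = 0) :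
    ∃ (_ : Group (characterSpace ℂ A)) (_ : IsTopologicalGroup (characterSpace ℂ A)),
      ∀ p q : characterSpace ℂ A, p * q = charMul hφ.nondegenerate p q := by
  have hm := continuous_charMul hφ.nondegenerate
  have eval₁ : ∀ (a b : A) p q,
      charExt (prodChar p q) (φ a * oneTmul b) =
        charMul hφ.nondegenerate p q a * q b := fun a b p q => by
    rw [charExt_mul, charExt_prodChar_oneTmul, charMul_apply]
  have eval₂ : ∀ (a b : A) p q,
      charExt (prodChar p q) (φ a * tmulOne b) =
        charMul hφ.nondegenerate p q a * p b := fun a b p q => by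
    rw [charExt_mul, charExt_prodChar_tmulOne, charMul_apply]
  exact exists_isTopologicalGroup (charMul hφ.nondegenerate) hm
    (charMul_assoc hφ)
    (isClosedMap_of_tmul_comp (hm.prodMk continuous_snd) fun a b => by
      obtain ⟨x, hx⟩ := h₁ a b
      exact ⟨x, fun y => (eval₁ a b _ _).symm.trans (by rw [hx, charExt_coe])⟩)
    (denseRange_of_tmul_comp fun a b h => inj₁ a b <|
      eq_zero_of_forall_charExt (h₁ a b).choose_spec fun p q =>
        (eval₁ a b p q).trans (h (p, q)))
    (isClosedMap_of_tmul_comp (hm.prodMk continuous_fst) fun a b => by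
      obtain ⟨x, hx⟩ := h₂ a b
      exact ⟨x, fun y => (eval₂ a b _ _).symm.trans (by rw [hx, charExt_coe])⟩)
    (denseRange_of_tmul_comp fun a b h => inj₂ a b <|
      eq_zero_of_forall_charExt (h₂ a b).choose_spec fun p q =>
        (eval₂ a b p q).trans (h (p, q)))

lemma minTensorEquiv_fst (hφ : IsNondegenerateHom φ) (f : A) (x : MinTensor A)
    (p q : characterSpace ℂ A) :
    minTensorEquiv ((φ f).fst x) (p, q) = charMul hφ p q f * minTensorEquiv x (p, q) := by
  rw [minTensorEquiv_apply, minTensorEquiv_apply, charMul_apply, char_fst]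

end GroupOfCharacters

end CStarTensor

theorem mainTheorem6 {A : Type u} [NonUnitalCommCStarAlgebra A] [Nontrivial A]
    (φ : A →⋆ₙₐ[ℂ] 𝓜(ℂ, CStarTensor.MinTensor A))
    (hφ : CStarTensor.IsComultiplication φ)
    (h₁ : ∀ a b : A, ∃ x : CStarTensor.MinTensor A,
      φ a * CStarTensor.oneTmul b = (x : 𝓜(ℂ, CStarTensor.MinTensor A)))
    (h₂ : ∀ a b : A, ∃ x : CStarTensor.MinTensor A,
      φ a * CStarTensor.tmulOne b = (x : 𝓜(ℂ, CStarTensor.MinTensor A)))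
    (inj₁ : ∀ a b : A, φ a * CStarTensor.oneTmul b = 0 → CStarTensor.tmul a b = 0)
    (inj₂ : ∀ a b : A, φ a * CStarTensor.tmulOne b = 0 → CStarTensor.tmul a b = 0) :
    ∃ (G : Type u) (_ : Group G) (_ : TopologicalSpace G) (_ : IsTopologicalGroup G)
      (_ : LocallyCompactSpace G) (_ : T2Space G)
      (Θ : A ≃⋆ₐ[ℂ] C₀(G, ℂ)) (Θ₂ : CStarTensor.MinTensor A ≃⋆ₐ[ℂ] C₀(G × G, ℂ)),
      (∀ (a b : A) (p q : G), Θ₂ (CStarTensor.tmul a b) (p, q) = Θ a p * Θ b q) ∧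
      ∀ (f : A) (x : CStarTensor.MinTensor A) (p q : G),
        Θ₂ ((φ f).fst x) (p, q) = Θ f (p * q) * Θ₂ x (p, q) := by
  obtain ⟨_, _, hmul⟩ := CStarTensor.exists_group_charMul hφ h₁ h₂ inj₁ inj₂
  refine ⟨WeakDual.characterSpace ℂ A, ‹_›, inferInstance, ‹_›, inferInstance, inferInstance,
    NonUnitalGelfand.gelfandStarEquiv A, CStarTensor.minTensorEquiv,
    fun a b p q => CStarTensor.prodChar_tmul p q a b, fun f x p q => ?_⟩
  rw [hmul]
  exact CStarTensor.minTensorEquiv_fst hφ.nondegenerate f x p q
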